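/- Let $V=\mathbb R$ or $V=\mathbb Z$. An array with $N$ columns and $m$ rows is a family $a(i,j)\ge 0$ ($1\le i\le N$, $1\le j\le m$; $i$ numbers the columns from left to right, $j$ the rows from bottom to top). Let $(\iint a)(i,j)=\sum_{i'\le i,\ j'\le j}a(i',j')$, and let $a\otimes b$ be the concatenation: the columns of $a$ followed by the columns of $b$. For $1\le j<m$ put $\beta_i=\sum_{k\le i}a(k,j+1)-\sum_{k<i}a(k,j)$. The operation $D_j$ leaves $a$ unchanged if all $\beta_i\le 0$; otherwise it moves the mass $\min(1,\beta_i-\max(0,\beta_1,\dots,\beta_{i-1}))$ from the box $(i,j+1)$ to the box $(i,j)$, where $i$ is the smallest index at which $\beta$ attains its maximum. Let $\mathbf D_j$ be the stable power of $D_j$, and let $\mathbf D=(\mathbf D_1\cdots\mathbf D_{m-1})^m$, $\mathbf L a=(\mathbf D a^T)^T$, where $T$ is the transposition. An array $a$ is $\mathbf D$-tight if $D_ja=a$ for all $j$, and $\mathbf L$-tight if $a^T$ is $\mathbf D$-tight. The shape of $a$ is the vector of row sums of $\mathbf D a$. Fix $n$, and call an $n$-tuple of real numbers $\lambda_1\ge\dots\ge\lambda_n\ge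 0$ a partition. $SP(\lambda,\mu,\nu)$ is the set of pairs $(a,b)$ of $n\times n$ arrays with entries in $V$ such that $a$ and $b$ are $\mathbf L$-tight, $a\otimes b$ is $\mathbf D$-tight, and $a$, $b$, $a\otimes b$ have the shapes $\lambda,\mu,\nu$. Let $\Delta_n=\{(i,j)\in\mathbb Z^2:0\le i\le j\le n\}$. $DC(\lambda,\mu,\nu)$ is the set of functions $f:\Delta_n\to V$ with $f(0,0)=0$ that satisfy the rhombus inequalities $$f(i,j)+f(i+1,j+1)\ge f(i+1,j)+f(i,j+1),$$ $$f(i,j+1)+f(i+1,j+1)\ge f(i+1,j+2)+f(i,j),$$ $$f(i+1,j)+f(i+1,j+1)\ge f(i,j)+f(i+2,j+1)$$ whenever the four points lie in $\Delta_n$, and have the increments $f(0,k)-f(0,k-1)=\lambda_k$, $f(k,n)-f(k-1,n)=\mu_k$, $f(k,k)-f(k-1,k-1)=\nu_k$ for $1\le k\le n$. Let $\Phi(a,b)$ be the function $(i,j)\mapsto(\iint(a\otimes b))(n+i,j)$ on $\Delta_n$. **Theorem 3.** For all partitions $\lambda,\mu,\nu$ with $n$ parts, $\Phi$ is a bijection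 $SP(\lambda,\mu,\nu)\to DC(\lambda,\mu,\nu)$. Let $\lambda,\mu,\nu,\pi$ be partitions with $n$ parts. 1. *Array associativity.* Every element of $\coprod_\sigma SP(\lambda,\mu,\sigma)\times SP(\sigma,\nu,\pi)$ has the form $((a,b),(\mathbf L(a\otimes b),c))$; here and below, all columns of $\mathbf L(a\otimes b)$ and $\mathbf L(b\otimes c)$ after the $n$-th are zero and are omitted. The map $$((a,b),(\mathbf L(a\otimes b),c))\mapsto\bigl((b',c'),\,(a,\mathbf L(b\otimes c))\bigr),\qquad b'\otimes c'=\mathbf D(b\otimes c),$$ is a bijection $$\coprod_\sigma SP(\lambda,\mu,\sigma)\times SP(\sigma,\nu,\pi)\to\coprod_\tau SP(\mu,\nu,\tau)\times SP(\lambda,\tau,\pi),$$ where $\sigma$ and $\tau$ run over all partitions with $n$ parts. 2. *Functional associativity.* For $(f,g)\in DC(\lambda,\mu,\sigma)\times DC(\sigma,\nu,\pi)$ let $F$ be the function on the integer points of the tetrahedron $0\le x\le y\le z\le n$ with $F(0,y,z)=f(y,z)$, $F(x,y,y)=g(x,y)$ and the octahedron recurrence $$F(x+1,y,z+1)=\max\bigl(F(x,y,z+1)+F(x+1,y,z),\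 F(x+1,y+1,z+1)+F(x,y-1,z)\bigr)-F(x,y,z)$$ for $0\le x<y\le z<n$. With $p(i,j)=F(i,j,n)-F(0,0,n)$ and $q(i,j)=F(i,i,j)$, the map $(f,g)\mapsto(p,q)$ is a bijection $$\coprod_\sigma DC(\lambda,\mu,\sigma)\times DC(\sigma,\nu,\pi)\to\coprod_\tau DC(\mu,\nu,\tau)\times DC(\lambda,\tau,\pi).$$ 3. The two bijections coincide under $\Phi$: if the map in 1 sends $(x_1,x_2)$ to $(y_1,y_2)$, then the map in 2 sends $(\Phi(x_1),\Phi(x_2))$ to $(\Phi(y_1),\Phi(y_2))$. -/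

import Mathlib

noncomputable section

namespace ArrayOR

/-! Arrays. An array with `n` columns and `m` rows is a function `a : Fin n → Fin m → ℝ`;
`a i j` is the mass of the box in column `i` and row `j`, with columns counted from the left and
rows counted from the bottom, both starting at `0`. Nonnegativity of the masses is
imposed in `IsStandardPair` below. -/

/-- An array with `n` columns and `m` rows. -/
abbrev Arr (n m : ℕ) : Type := Fin n → Fin m → ℝ

/-- The transposed array. -/
def transp {n m : ℕ} (a : Arr n m) : Arr m n := fun j i => a i j

/-- The concatenation `a ⊗ b`: first the columns of `a`, then the columns of `b`. -/
def concat {n n' m : ℕ} (a : Arr n m) (b : Arr n' m) : Arr (n + n') m := Fin.append a b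

/-- The function `∫∫ a`: its value at `(i, j)` is the total mass of the first `i` columns
within the first `j` rows. -/
def dint {n m : ℕ} (a : Arr n m) (i j : ℕ) : ℝ :=
  ∑ p : Fin n, ∑ q : Fin m, if (p : ℕ) < i ∧ (q : ℕ) < j then a p q else 0

/-- `β_i = a(0,hi) + … + a(i,hi) - a(0,lo) - … - a(i-1,lo)`, for two rows `lo` and `hi`. -/
def excess {n m : ℕ} (lo hi : Fin m) (a : Arr n m) (i : Fin n) : ℝ :=
  ∑ k ∈ Finset.univ.filter (fun k : Fin n => k ≤ i), a k hi
    - ∑ k ∈ Finset.univ.filter (fun k : Fin n => k < i), a k lo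

/-- `max (0, β_0, …, β_{i-1})`. -/
def prevMax {n m : ℕ} (lo hi : Fin m) (a : Arr n m) (i : Fin n) : ℝ :=
  (Finset.univ.filter (fun k : Fin n => k < i)).fold max 0 (excess lo hi a)

open Classical in
/-- The mass which one elementary move takes out of the box `(i, hi)`. If all `β` are `≤ 0`, nothing
moves. Otherwise, mass is taken only out of the column `i` where the maximum of `β` is attained for
the first time, namely one unit, or all that exceeds the earlier values of `β` if this is less. -/
def moveAmount {n m : ℕ} (lo hi : Fin m) (a : Arr n m) (i : Fin n) : ℝ :=
  if prevMax lo hi a i < excess lo hi a i ∧ ∀ k, excess lo hi a k ≤ excess lo hi a i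
  then min 1 (excess lo hi a i - prevMax lo hi a i) else 0

/-- One elementary move of mass from the row `hi` to the row `lo`, within one column. -/
def moveDown {n m : ℕ} (lo hi : Fin m) (a : Arr n m) : Arr n m := fun i j =>
  if j = lo then a i j + moveAmount lo hi a i
  else if j = hi then a i j - moveAmount lo hi a i
  else a i j

/-- The operation `D_j`, which moves mass from the row `j + 1` to the row `j` (and the identity if
there is no row `j + 1`). -/
def opD {n m : ℕ} (j : ℕ) (a : Arr n m) : Arr n m :=
  if h : j + 1 < m then moveDown ⟨j, Nat.lt_of_succ_lt h⟩ ⟨j + 1, h⟩ a else a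

/-- The least `ε` with `D_j^{ε+1} a = D_j^ε a`. -/
def epsD {n m : ℕ} (j : ℕ) (a : Arr n m) : ℕ :=
  sInf {e : ℕ | (opD j)^[e + 1] a = (opD j)^[e] a}

/-- The operation `𝐃_j = D_j^{+∞}`: the stable power of `D_j`. -/
def boldDj {n m : ℕ} (j : ℕ) (a : Arr n m) : Arr n m := (opD j)^[epsD j a] a

/-- The product `𝐃_0 𝐃_1 ⋯ 𝐃_{m-2}` (the rightmost factor acts first). -/
def passD {n m : ℕ} (a : Arr n m) : Arr n m := (List.range (m - 1)).foldr boldDj a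

/-- The condensation `𝐃 a = (𝐃_0 𝐃_1 ⋯ 𝐃_{m-2})^m a`. -/
def boldD {n m : ℕ} (a : Arr n m) : Arr n m := passD^[m] a

/-- The condensation to the left, `𝐋 a = (𝐃 aᵀ)ᵀ`. -/
def boldL {n m : ℕ} (a : Arr n m) : Arr n m := transp (boldD (transp a))

/-- `a` is `𝐃`-tight: `D_j a = a` for all `j`. -/
def IsDTight {n m : ℕ} (a : Arr n m) : Prop := ∀ j, opD j a = a

/-- `a` is `𝐋`-tight: `L_i a = a` for all `i`, where `L_i a = (D_i aᵀ)ᵀ`. -/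
def IsLTight {n m : ℕ} (a : Arr n m) : Prop := IsDTight (transp a)

/-- The shape of `a`: the row sums of `𝐃 a`. -/
def shape {n m : ℕ} (a : Arr n m) : Fin m → ℝ := fun j => ∑ i, boldD a i j

/-- A partition with `n` parts, not necessarily integral: `α_1 ≥ α_2 ≥ … ≥ α_n ≥ 0`. -/
def IsPartition {n : ℕ} (α : Fin n → ℝ) : Prop := Antitone α ∧ ∀ i, 0 ≤ α i

/-- Standard pairs of square arrays: the arrays `a`, `b` have nonnegative masses, they
are `𝐋`-tight, and `a ⊗ b` is `𝐃`-tight. -/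
def IsStandardPair {n : ℕ} (a b : Arr n n) : Prop :=
  (∀ i j, 0 ≤ a i j) ∧ (∀ i j, 0 ≤ b i j) ∧ IsLTight a ∧ IsLTight b ∧ IsDTight (concat a b)

/-- `SP(α, β, γ)`: the standard pairs with starting shape `α`, intermediate shape `β`,
final shape `γ`, and with masses in `V`; here `V` is `ℝ` or `ℤ`. -/
def SP {n : ℕ} (V : Set ℝ) (α β γ : Fin n → ℝ) : Set (Arr n n × Arr n n) :=
  {x | IsStandardPair x.1 x.2 ∧ shape x.1 = α ∧ shape x.2 = β ∧ shape (concat x.1 x.2) = γ ∧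
    (∀ i j, x.1 i j ∈ V) ∧ (∀ i j, x.2 i j ∈ V)}

/-! Discrete concave functions. The triangular grid `Δ_n` consists of the points `(i, j)` with
`0 ≤ i ≤ j ≤ n`. A function on it is represented by a function `ℕ → ℕ → ℝ` that vanishes off it. -/

/-- The restriction of `h` to the grid `Δ_n`. -/
def onGrid (n : ℕ) (h : ℕ → ℕ → ℝ) : ℕ → ℕ → ℝ := fun i j => if i ≤ j ∧ j ≤ n then h i j else 0

/-- The three kinds of rhombus inequalities, for all primitive rhombuses inside the grid `Δ_n`. -/
def IsDiscreteConcave (n : ℕ) (f : ℕ → ℕ → ℝ) : Prop :=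
  (∀ i j, i + 1 ≤ j → j + 1 ≤ n → f (i + 1) j + f i (j + 1) ≤ f i j + f (i + 1) (j + 1)) ∧
  (∀ i j, i ≤ j → j + 2 ≤ n → f (i + 1) (j + 2) + f i j ≤ f i (j + 1) + f (i + 1) (j + 1)) ∧
  (∀ i j, i + 1 ≤ j → j + 1 ≤ n → f i j + f (i + 2) (j + 1) ≤ f (i + 1) j + f (i + 1) (j + 1))

/-- `DC(α, β, γ)`: the discrete concave functions on `Δ_n`, normalized by `f(0,0) = 0`, with
increments `α` along the side `(0,0)(0,n)`, `β` along the side `(0,n)(n,n)`, and `γ` along the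
hypotenuse `(0,0)(n,n)`, and with values in `V`; here `V` is `ℝ` or `ℤ`. -/
def DC {n : ℕ} (V : Set ℝ) (α β γ : Fin n → ℝ) : Set (ℕ → ℕ → ℝ) :=
  {f | (∀ i j, ¬(i ≤ j ∧ j ≤ n) → f i j = 0) ∧ f 0 0 = 0 ∧ IsDiscreteConcave n f ∧
    (∀ k : Fin n, f 0 (k + 1) - f 0 k = α k) ∧
    (∀ k : Fin n, f (k + 1) n - f k n = β k) ∧
    (∀ k : Fin n, f (k + 1) (k + 1) - f k k = γ k) ∧
    (∀ i j, f i j ∈ V)}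

/-- The map `SP → DC`: the function `∫∫ (a ⊗ b)` at the points `(n + i, j)`, `0 ≤ i ≤ j ≤ n`. -/
def toDC {n : ℕ} (x : Arr n n × Arr n n) : ℕ → ℕ → ℝ :=
  onGrid n (fun i j => dint (concat x.1 x.2) (n + i) j)

/-! The two sides of an associativity bijection. For a family `S` of sets
of a kind (`SP` or `DC`), the two disjoint unions over `σ`, resp. `τ`, are given as sets of pairs;
the index `σ`, resp. `τ`, is determined by the members of the pair. -/

/-- `∐_σ S(lam, mu, σ) × S(σ, nu, ro)`. -/
def leftCouples {n : ℕ} {X : Type} (S : (Fin n → ℝ) → (Fin n → ℝ) → (Fin n → ℝ) → Set X)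
    (lam mu nu ro : Fin n → ℝ) : Set (X × X) :=
  {x | ∃ σ, IsPartition σ ∧ x.1 ∈ S lam mu σ ∧ x.2 ∈ S σ nu ro}

/-- `∐_τ S(mu, nu, τ) × S(lam, τ, ro)`. -/
def rightCouples {n : ℕ} {X : Type} (S : (Fin n → ℝ) → (Fin n → ℝ) → (Fin n → ℝ) → Set X)
    (lam mu nu ro : Fin n → ℝ) : Set (X × X) :=
  {x | ∃ τ, IsPartition τ ∧ x.1 ∈ S mu nu τ ∧ x.2 ∈ S lam τ ro}

/-- The first `n` columns of an array with `2n` columns. -/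
def firstHalf {n m : ℕ} (a : Arr (n + n) m) : Arr n m := fun i => a (Fin.castAdd n i)

/-- The last `n` columns of an array with `2n` columns. -/
def secondHalf {n m : ℕ} (a : Arr (n + n) m) : Arr n m := fun i => a (Fin.natAdd n i)

/-- The array associativity map. It sends `((a, b), (l, c))`, where `l = 𝐋(a ⊗ b)`, to the couple
formed by the pair `𝐃(b, c) = (b', c')`, where `b' ⊗ c' = 𝐃(b ⊗ c)`, and the pair
`(a, 𝐋(b ⊗ c))`. Of the `𝐋`-tight arrays only the first `n` columns are kept: all
others are zero. -/
def arrayAssoc {n : ℕ} (x : (Arr n n × Arr n n) × (Arr n n × Arr n n)) :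
    (Arr n n × Arr n n) × (Arr n n × Arr n n) :=
  ((firstHalf (boldD (concat x.1.2 x.2.2)), secondHalf (boldD (concat x.1.2 x.2.2))),
    (x.1.1, firstHalf (boldL (concat x.1.2 x.2.2))))

/-- The octahedron recurrence with propagation vector `(1,0,1)` in the tetrahedron
`0 ≤ x ≤ y ≤ z` with initial data `f` on the face `x = 0` and `g` on the face `y = z`; the
number `propagate f g x y d` is the value `F(x, y, y + d)`. In terms of the coordinates, the rule is
`F(x+1,y,z+1) = max (F(x,y,z+1) + F(x+1,y,z)) (F(x+1,y+1,z+1) + F(x,y-1,z)) - F(x,y,z)`,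
where `x + 1 ≤ y ≤ z`. -/
def propagate (f g : ℕ → ℕ → ℝ) : ℕ → ℕ → ℕ → ℝ
  | 0, y, d => f y (y + d)
  | x + 1, y, 0 => g (x + 1) y
  | x + 1, y, d + 1 =>
      max (propagate f g x y (d + 1) + propagate f g (x + 1) y d)
        (propagate f g (x + 1) (y + 1) d + propagate f g x (y - 1) (d + 1))
      - propagate f g x y d
  termination_by x _ d => (x, d)

/-- The value at `(x, y, z)`, `0 ≤ x ≤ y ≤ z`, of the function propagated from the initial data
`F(0, y, z) = f(y, z)` and `F(x, y, y) = g(x, y)`. -/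
def tetra (f g : ℕ → ℕ → ℝ) (x y z : ℕ) : ℝ := propagate f g x y (z - y)

/-- The functional associativity map. The functions `f` and `g` are put on the faces `x = 0` and
`y = z` of the tetrahedron `0 ≤ x ≤ y ≤ z ≤ n` and propagated by the octahedron recurrence. The
result is the pair of the functions on the two other faces, `z = n` (with a constant
subtracted, so that it vanishes at the vertex `(0, 0, n)`) and `x = y`. -/
def funAssoc (n : ℕ) (x : (ℕ → ℕ → ℝ) × (ℕ → ℕ → ℝ)) : (ℕ → ℕ → ℝ) × (ℕ → ℕ → ℝ) :=
  (onGrid n (fun i j => tetra x.1 x.2 i j n - tetra x.1 x.2 0 0 n),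
    onGrid n (fun i j => tetra x.1 x.2 i i j))

end ArrayOR

end

noncomputable section

namespace ArrayOR

/-! ### Piecewise linear operations on functions of two variables. -/

section

/-! Everything is read off the integrals $f=\iint a$. In these terms the stable power $\mathbf D_j$
replaces a line $v$ of $f$, lying between lines $u$ and $w$, by the solution $v'$ of
$v'_{i+1}+v_i=\max(v'_i+v_{i+1},\,w_{i+1}+u_i)$ with $v'_0=v_0$ (`dint_boldDj`). Piecewise linear
identities give the relations of the 0-Hecke monoid (`colT_idem`, `colT_comm`, `colT_braid`) and the
commutation of row operations with column operations (`colT_rowT_comm`). Hence $\mathbf D$ and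
$\mathbf L$ produce tight arrays, commute, and each preserves tightness in the other direction
(`colT_slack`). An array that is tight in both directions is diagonal, so its shape determines it
(`IsIntegral.eq_diag`).

For a standard pair this makes $a$ diagonal, while $b$ has mass only on and above the diagonal. The
three kinds of rhombus inequalities are then nonnegativity of $b$, tightness of $a\otimes b$
downwards and tightness of $b$ to the left; this gives `bijOn_toDC`.

For associativity, let $G(x,y,z)$ be the value at $(y,z)$ of the integral of $b\otimes c$ after the
first $x$ columns of $c$ have been inserted into $b$ by column operations. One insertion runs
through the lines from right to left, so each line sees its new right neighbour and its old left
neighbour: this is the octahedron recurrence in $(x,y,z)$. With the row sums of $a$ added, $G$ has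
the two given functions on the faces $x=0$ and $y=z$ (`tetra_eq`), while the faces $z=n$ and $x=y$
carry $\mathbf D(b\otimes c)$ and $\mathbf L(b\otimes c)$ (`insertCols_top`, `insertCols_diag`). So
the two associativity maps coincide under $\Phi$.

Bijectivity is proved for functions. The recurrence is invariant under
$(x,y,z)\mapsto(n-z,n-y,n-x)$, which exchanges initial and final faces; final faces therefore
determine the solution, and every right couple is reached by reflecting, propagating and reflecting
back (`funAssoc_reflect`). The result is carried to arrays by $\Phi$. -/

/-- The line `v` between the lines `u` and `w` after the stable move of mass: in terms of the
integrals of an array, this is what `𝐃_j` does to the line number `j + 1`. -/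
def upd (u v w : ℕ → ℝ) : ℕ → ℝ
  | 0 => v 0
  | i + 1 => max (upd u v w i + v (i + 1)) (w (i + 1) + u i) - v i

@[simp] lemma upd_zero (u v w : ℕ → ℝ) : upd u v w 0 = v 0 := rfl

lemma upd_succ (u v w : ℕ → ℝ) (i : ℕ) :
    upd u v w (i + 1) = max (upd u v w i + v (i + 1)) (w (i + 1) + u i) - v i := rfl

lemma upd_step (u v w : ℕ → ℝ) (i : ℕ) :
    upd u v w i + v (i + 1) ≤ upd u v w (i + 1) + v i := by
  rw [upd_succ]; linarith [le_max_left (upd u v w i + v (i + 1)) (w (i + 1) + u i)]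

lemma upd_ge (u v w : ℕ → ℝ) (i : ℕ) :
    w (i + 1) + u i ≤ upd u v w (i + 1) + v i := by
  rw [upd_succ]; linarith [le_max_right (upd u v w i + v (i + 1)) (w (i + 1) + u i)]

lemma le_upd (u v w : ℕ → ℝ) (i : ℕ) : v i ≤ upd u v w i := by
  induction i with
  | zero => simp
  | succ i ih => linarith [upd_step u v w i]

lemma upd_eq_self_iff (u v w : ℕ → ℝ) :
    upd u v w = v ↔ ∀ i, w (i + 1) + u i ≤ v (i + 1) + v i := by
  constructor
  · intro h i
    have := upd_ge u v w i
    rwa [h] at this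
  · intro h
    funext i
    induction i with
    | zero => rfl
    | succ i ih =>
      rw [upd_succ, ih, max_eq_left (by linarith [h i])]; ring

lemma upd_idem (u v w : ℕ → ℝ) : upd u (upd u v w) w = upd u v w := by
  rw [upd_eq_self_iff]
  intro i
  linarith [upd_ge u v w i, le_upd u v w i]

lemma upd_mem (S : AddSubgroup ℝ) {u v w : ℕ → ℝ} (hu : ∀ i, u i ∈ S) (hv : ∀ i, v i ∈ S)
    (hw : ∀ i, w i ∈ S) (i : ℕ) : upd u v w i ∈ S := by
  induction i with
  | zero => exact hv 0
  | succ i ih =>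
    rw [upd_succ]
    refine S.sub_mem ?_ (hv i)
    rcases max_choice (upd u v w i + v (i + 1)) (w (i + 1) + u i) with h | h <;> rw [h]
    · exact S.add_mem ih (hv _)
    · exact S.add_mem (hw _) (hu _)

/-- One step along the lines in the braid relation; primes denote the next position. The two
equalities alone do not propagate: the relation `hR` between the intermediate lines of both sides
has to be carried along. -/
lemma braid_step {u v w v₁ w₁ v₂ W₁ v' w' t' v₁' w₁' W₁' v₂' V₁' W₂' : ℝ}
    (hR : W₁ + v₁ = max (v₂ + w) (w₁ + v))
    (h1 : v₁' = max (v₁ + v') (w' + u) - v) (h2 : w₁' = max (w₁ + w') (t' + v₁) - w)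
    (h3 : v₂' = max (v₂ + v₁') (w₁' + u) - v₁) (h4 : W₁' = max (W₁ + w') (t' + v) - w)
    (h5 : V₁' = max (v₂ + v') (W₁' + u) - v) (h6 : W₂' = max (w₁ + W₁') (t' + v₂) - W₁) :
    v₂' = V₁' ∧ w₁' = W₂' ∧ W₁' + v₁' = max (v₂' + w') (w₁' + v') := by
  have e1 : v₂' = V₁' := by
    subst h1 h2 h3 h4 h5
    simp only [max_def] at *
    split_ifs at * <;> linarith
  have e2 : w₁' = W₂' := by
    subst h2 h4 h6
    simp only [max_def] at *
    split_ifs at * <;> linarith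
  refine ⟨e1, e2, ?_⟩
  rw [h3, h2, h4, h1]
  simp only [max_def] at hR ⊢
  split_ifs at * <;> linarith

lemma upd_braid (u v w t : ℕ → ℝ) :
    upd u (upd u v w) (upd (upd u v w) w t) = upd u v (upd v w t) ∧
      upd (upd u v w) w t = upd (upd u v (upd v w t)) (upd v w t) t := by
  have key : ∀ i, upd u (upd u v w) (upd (upd u v w) w t) i = upd u v (upd v w t) i ∧
      upd (upd u v w) w t i = upd (upd u v (upd v w t)) (upd v w t) t i ∧
      upd v w t i + upd u v w i = max (upd u (upd u v w) (upd (upd u v w) w t) i + w i)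
        (upd (upd u v w) w t i + v i) := by
    intro i
    induction i with
    | zero => simp [add_comm]
    | succ i ih =>
      obtain ⟨h1, h2, h3⟩ := ih
      refine braid_step h3 (upd_succ u v w i) (upd_succ _ _ _ i) (upd_succ _ _ _ i)
        (upd_succ _ _ _ i) ?_ ?_
      · rw [h1]; exact upd_succ _ _ _ i
      · rw [h1, h2]; exact upd_succ _ _ _ i
  exact ⟨funext fun i => (key i).1, funext fun i => (key i).2.1⟩

/-- The stable operation on the line number `s + 1`, where `f s` is the line number `s`. -/
def colT (s : ℕ) (f : ℕ → ℕ → ℝ) : ℕ → ℕ → ℝ :=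
  Function.update f (s + 1) (upd (f s) (f (s + 1)) (f (s + 2)))

/-- The transposed version of `colT`. -/
def rowT (j : ℕ) (f : ℕ → ℕ → ℝ) : ℕ → ℕ → ℝ := fun i k => colT j (fun k i => f i k) k i

lemma colT_line (s : ℕ) (f : ℕ → ℕ → ℝ) :
    colT s f (s + 1) = upd (f s) (f (s + 1)) (f (s + 2)) := by simp [colT]

lemma colT_of_ne {s i : ℕ} (f : ℕ → ℕ → ℝ) (h : i ≠ s + 1) : colT s f i = f i := by
  simp [colT, h]

lemma rowT_of_ne {j k : ℕ} (f : ℕ → ℕ → ℝ) (i : ℕ) (h : k ≠ j + 1) : rowT j f i k = f i k := by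
  simp [rowT, colT_of_ne _ h]

lemma rowT_line (j : ℕ) (f : ℕ → ℕ → ℝ) (i : ℕ) :
    rowT j f i (j + 1) = upd (fun i => f i j) (fun i => f i (j + 1)) (fun i => f i (j + 2)) i := by
  simp [rowT, colT_line]

lemma colT_eq_self_iff {s : ℕ} {f : ℕ → ℕ → ℝ} :
    colT s f = f ↔ ∀ k, f (s + 2) (k + 1) + f s k ≤ f (s + 1) (k + 1) + f (s + 1) k := by
  rw [← upd_eq_self_iff, ← colT_line]
  constructor
  · intro h; rw [h]
  · intro h
    funext i
    by_cases hi : i = s + 1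
    · rw [hi, h]
    · rw [colT_of_ne _ hi]

lemma rowT_eq_self_iff {j : ℕ} {f : ℕ → ℕ → ℝ} :
    rowT j f = f ↔ ∀ i, f (i + 1) (j + 2) + f i j ≤ f (i + 1) (j + 1) + f i (j + 1) := by
  rw [← colT_eq_self_iff (s := j) (f := fun k i => f i k)]
  constructor
  · intro h; funext k i; exact congrFun (congrFun h i) k
  · intro h; funext i k; exact congrFun (congrFun h k) i

lemma colT_idem (s : ℕ) (f : ℕ → ℕ → ℝ) : colT s (colT s f) = colT s f := by
  have h1 : colT s f s = f s := colT_of_ne _ (by omega)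
  have h2 : colT s f (s + 2) = f (s + 2) := colT_of_ne _ (by omega)
  funext i
  by_cases hi : i = s + 1
  · rw [hi, colT_line, h1, h2, colT_line, upd_idem]
  · rw [colT_of_ne _ hi]

lemma colT_comm {s r : ℕ} (h : s + 2 ≤ r) (f : ℕ → ℕ → ℝ) :
    colT s (colT r f) = colT r (colT s f) := by
  funext i
  by_cases hi : i = s + 1
  · subst hi
    rw [colT_line, colT_of_ne (s := r) _ (by omega), colT_of_ne (s := r) _ (by omega),
      colT_of_ne (s := r) _ (by omega), colT_of_ne (s := r) _ (by omega), colT_line]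
  · rw [colT_of_ne _ hi]
    by_cases hr : i = r + 1
    · subst hr
      rw [colT_line, colT_line, colT_of_ne (s := s) _ (by omega),
        colT_of_ne (s := s) _ (by omega), colT_of_ne (s := s) _ (by omega)]
    · rw [colT_of_ne _ hr, colT_of_ne _ hr, colT_of_ne _ hi]

lemma colT_braid (s : ℕ) (f : ℕ → ℕ → ℝ) :
    colT s (colT (s + 1) (colT s f)) = colT (s + 1) (colT s (colT (s + 1) f)) := by
  obtain ⟨h1, h2⟩ := upd_braid (f s) (f (s + 1)) (f (s + 2)) (f (s + 3))
  have e : ∀ r (g : ℕ → ℕ → ℝ) i, colT r g i =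
      if i = r + 1 then upd (g r) (g (r + 1)) (g (r + 2)) else g i := by
    intro r g i
    split_ifs with h
    · rw [h, colT_line]
    · rw [colT_of_ne _ h]
  have n1 : ¬ s = s + 1 + 1 := by omega
  funext i
  by_cases hi : i = s + 1
  · subst hi
    simp [e, n1]
    exact h1
  · by_cases hi' : i = s + 2
    · subst hi'
      simp [e, n1]
      exact h2
    · simp [e, hi, hi']

lemma rowT_idem (s : ℕ) (f : ℕ → ℕ → ℝ) : rowT s (rowT s f) = rowT s f := by
  funext i k; exact congrFun (congrFun (colT_idem s fun k i => f i k) k) i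

lemma rowT_comm {s r : ℕ} (h : s + 2 ≤ r) (f : ℕ → ℕ → ℝ) :
    rowT s (rowT r f) = rowT r (rowT s f) := by
  funext i k; exact congrFun (congrFun (colT_comm h fun k i => f i k) k) i

lemma rowT_braid (s : ℕ) (f : ℕ → ℕ → ℝ) :
    rowT s (rowT (s + 1) (rowT s f)) = rowT (s + 1) (rowT s (rowT (s + 1) f)) := by
  funext i k; exact congrFun (congrFun (colT_braid s fun k i => f i k) k) i

/-! Commutation of the operations on columns and on rows. -/

/-- Consistency of the recurrence around a cube: the vertex where a column line meets a row line
gets the same value from either order of the two operations. -/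
lemma cube_symm_aux {a b c d e f g l r : ℝ} :
    max (l + (max (r + e) (f + a) - d)) (max ((max (r + e) (f + a) - d) + g) (c + b) - e + a) - b =
    max (r + (max (l + e) (g + a) - b)) (max ((max (l + e) (g + a) - b) + f) (c + d) - e + a) - d := by
  simp only [max_def]
  split_ifs <;> linarith

lemma cube_next_aux {a b c d e f g l r : ℝ} :
    max ((max (l + (max (r + e) (f + a) - d))
        (max ((max (r + e) (f + a) - d) + g) (c + b) - e + a) - b) + f) (c + r)
      - (max (r + e) (f + a) - d) = max ((max (l + e) (g + a) - b) + f) (c + d) - e := by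
  simp only [max_def]
  split_ifs <;> linarith

/-- The value at `(s + 1, j + 1)` after the operations on the column line `s + 1` and on the
row line `j + 1`. -/
def crossing (s j : ℕ) (f : ℕ → ℕ → ℝ) : ℝ :=
  max (colT s f (s + 1) j + rowT j f (s + 1) (j + 1)) (rowT j f (s + 2) (j + 1) + f s j)
    - f (s + 1) j

lemma crossing_symm (s j : ℕ) (f : ℕ → ℕ → ℝ) :
    crossing s j f = crossing j s (fun k i => f i k) := by
  have h1 : ∀ i, rowT j f i (j + 1) = colT j (fun k i => f i k) (j + 1) i := fun i => rfl
  have h2 : ∀ k, rowT s (fun k i => f i k) k (s + 1) = colT s f (s + 1) k := fun i => rfl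
  simp only [crossing, h1, h2, colT_line, upd_succ]
  exact cube_symm_aux

/-- Below height `j + 1` the row operation leaves the data of the recurrence untouched. At height `j
+ 2` the disturbance cancels, by `cube_next_aux`, and from there on the recurrence again has the
undisturbed data. -/
lemma colT_rowT_line (s j : ℕ) (f : ℕ → ℕ → ℝ) (k : ℕ) :
    colT s (rowT j f) (s + 1) k = if k = j + 1 then crossing s j f else colT s f (s + 1) k := by
  have hlow : ∀ k ≤ j, colT s (rowT j f) (s + 1) k = colT s f (s + 1) k := by
    intro k
    induction k with
    | zero => intro _; simp only [colT_line, upd_zero]; exact rowT_of_ne _ _ (by omega)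
    | succ k ih =>
      intro hk
      have := ih (by omega)
      simp only [colT_line, upd_succ] at this ⊢
      rw [this, rowT_of_ne _ _ (by omega), rowT_of_ne _ _ (by omega), rowT_of_ne _ _ (by omega),
        rowT_of_ne _ _ (by omega)]
  have hmid : colT s (rowT j f) (s + 1) (j + 1) = crossing s j f := by
    have := hlow j le_rfl
    rw [colT_line] at this
    rw [crossing, colT_line, upd_succ, this, rowT_of_ne (k := j) _ _ (by omega),
      rowT_of_ne (k := j) _ _ (by omega)]
  have hhigh : ∀ d, colT s (rowT j f) (s + 1) (j + 2 + d) = colT s f (s + 1) (j + 2 + d) := by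
    intro d
    induction d with
    | zero =>
      rw [add_zero, colT_line, upd_succ, ← colT_line, hmid, rowT_of_ne (k := j + 1 + 1) _ _ (by omega),
        rowT_of_ne (k := j + 1 + 1) _ _ (by omega), crossing]
      simp only [rowT_line, colT_line, upd_succ]
      exact cube_next_aux
    | succ d ih =>
      rw [← add_assoc, colT_line, upd_succ, ← colT_line, ih, rowT_of_ne _ _ (by omega),
        rowT_of_ne _ _ (by omega), rowT_of_ne _ _ (by omega), rowT_of_ne _ _ (by omega),
        colT_line s f, upd_succ]
  split_ifs with h
  · rw [h, hmid]
  · rcases Nat.lt_or_ge k (j + 1) with h' | h'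
    · exact hlow k (by omega)
    · obtain ⟨d, rfl⟩ : ∃ d, k = j + 2 + d := ⟨k - (j + 2), by omega⟩
      exact hhigh d

lemma colT_rowT_comm (s j : ℕ) (f : ℕ → ℕ → ℝ) : colT s (rowT j f) = rowT j (colT s f) := by
  funext i k
  have e : rowT j (colT s f) i k = colT j (rowT s fun k i => f i k) k i := rfl
  rw [e]
  by_cases hi : i = s + 1
  · subst hi
    rw [colT_rowT_line]
    split_ifs with hk
    · subst hk
      rw [colT_rowT_line, if_pos rfl, crossing_symm]
    · rw [colT_of_ne _ hk]; rfl
  · rw [colT_of_ne _ hi]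
    by_cases hk : k = j + 1
    · subst hk
      rw [colT_rowT_line, if_neg hi]; rfl
    · rw [colT_of_ne _ hk, rowT_of_ne _ _ hk, rowT_of_ne _ _ hi]

/-! The operations preserve tightness in the other direction. -/

/-- For `κ = 0` the inequality is row tightness. A constant `κ` is needed for an array that stands
to the right of another one, whose row sums then contribute a constant. -/
lemma colT_slack {j : ℕ} {κ : ℝ} {f : ℕ → ℕ → ℝ} (s : ℕ)
    (h : ∀ i, f (i + 1) (j + 2) + f i j ≤ f (i + 1) (j + 1) + f i (j + 1) + κ) (i : ℕ) :
    colT s f (i + 1) (j + 2) + colT s f i j ≤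
      colT s f (i + 1) (j + 1) + colT s f i (j + 1) + κ := by
  by_cases hi : i = s
  · subst hi
    rw [colT_line, colT_of_ne (i := i) _ (by omega), upd_succ]
    rcases max_choice (upd (f i) (f (i + 1)) (f (i + 2)) (j + 1) + f (i + 1) (j + 1 + 1))
      (f (i + 2) (j + 1 + 1) + f i (j + 1)) with hm | hm <;> rw [hm]
    · linarith [h i]
    · linarith [h (i + 1), upd_ge (f i) (f (i + 1)) (f (i + 2)) j]
  · rw [colT_of_ne (i := i + 1) _ (by omega)]
    by_cases hi' : i = s + 1
    · subst hi'
      rw [colT_line]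
      linarith [h (s + 1), upd_step (f s) (f (s + 1)) (f (s + 2)) j]
    · rw [colT_of_ne _ hi']
      exact h i

lemma rowT_slack {s : ℕ} {κ : ℝ} {f : ℕ → ℕ → ℝ} (j : ℕ)
    (h : ∀ k, f (s + 2) (k + 1) + f s k ≤ f (s + 1) (k + 1) + f (s + 1) k + κ) (k : ℕ) :
    rowT j f (s + 2) (k + 1) + rowT j f s k ≤
      rowT j f (s + 1) (k + 1) + rowT j f (s + 1) k + κ :=
  colT_slack (f := fun k i => f i k) j h k

/-- The integrals of arrays with nonnegative masses. -/
structure IsIntegral (f : ℕ → ℕ → ℝ) : Prop where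
  left : ∀ j, f 0 j = 0
  bot : ∀ i, f i 0 = 0
  mass : ∀ i j, f (i + 1) j + f i (j + 1) ≤ f (i + 1) (j + 1) + f i j

lemma IsIntegral.swap {f : ℕ → ℕ → ℝ} (h : IsIntegral f) : IsIntegral (fun k i => f i k) :=
  ⟨h.bot, h.left, fun i j => by linarith [h.mass j i]⟩

lemma IsIntegral.mono_left {f : ℕ → ℕ → ℝ} (h : IsIntegral f) (i j : ℕ) :
    f i j ≤ f (i + 1) j := by
  induction j with
  | zero => rw [h.bot, h.bot]
  | succ j ih => linarith [h.mass i j]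

lemma IsIntegral.mono_right {f : ℕ → ℕ → ℝ} (h : IsIntegral f) (i j : ℕ) :
    f i j ≤ f i (j + 1) := h.swap.mono_left j i

lemma IsIntegral.map_colT {f : ℕ → ℕ → ℝ} (h : IsIntegral f) (s : ℕ) :
    IsIntegral (colT s f) := by
  refine ⟨fun j => ?_, fun i => ?_, fun i j => ?_⟩
  · rw [colT_of_ne _ (by omega), h.left]
  · by_cases hi : i = s + 1
    · rw [hi, colT_line, upd_zero, h.bot]
    · rw [colT_of_ne _ hi, h.bot]
  · by_cases hi : i = s
    · subst hi
      rw [colT_line, colT_of_ne (i := i) _ (by omega)]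
      linarith [h.mass i j, upd_step (f i) (f (i + 1)) (f (i + 2)) j]
    · rw [colT_of_ne (i := i + 1) _ (by omega)]
      by_cases hi' : i = s + 1
      · subst hi'
        rw [colT_line, upd_succ]
        rcases max_choice (upd (f s) (f (s + 1)) (f (s + 2)) j + f (s + 1) (j + 1))
          (f (s + 2) (j + 1) + f s j) with hm | hm <;> rw [hm]
        · linarith [h.mass (s + 1) j]
        · cases j with
          | zero => simp [h.bot]
          | succ j => linarith [h.mass s j, upd_ge (f s) (f (s + 1)) (f (s + 2)) j]
      · rw [colT_of_ne _ hi']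
        exact h.mass i j

lemma IsIntegral.map_rowT {f : ℕ → ℕ → ℝ} (h : IsIntegral f) (j : ℕ) :
    IsIntegral (rowT j f) :=
  (h.swap.map_colT j).swap

/-- If the first `M` columns are tight to the left, then they have no mass to the right of the
diagonal. -/
lemma IsIntegral.eq_diag {f : ℕ → ℕ → ℝ} (h : IsIntegral f) {M : ℕ}
    (ht : ∀ s, s + 2 ≤ M → colT s f = f) {i j : ℕ} (hj : j ≤ i) (hi : i ≤ M) :
    f i j = f j j := by
  have key : ∀ j i, j ≤ i → i + 1 ≤ M → f (i + 1) j = f i j := by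
    intro j
    induction j with
    | zero => intro i _ _; rw [h.bot, h.bot]
    | succ j ih =>
      intro i hji hi
      obtain ⟨i, rfl⟩ : ∃ i', i = i' + 1 := ⟨i - 1, by omega⟩
      have h1 := colT_eq_self_iff.1 (ht i (by omega)) j
      have h2 := ih i (by omega) (by omega)
      linarith [h.mono_left (i + 1) (j + 1)]
  induction i, hj using Nat.le_induction with
  | base => rfl
  | succ i hj ih => rw [key j i hj hi, ih (by omega)]

/-! Words in operations with the relations of the `0`-Hecke monoid. -/

/-- The product `D 0 ∘ D 1 ∘ ⋯ ∘ D (k - 1)`. -/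
def sweep {X : Type*} (D : ℕ → X → X) : ℕ → X → X
  | 0, x => x
  | k + 1, x => sweep D k (D k x)

lemma sweep_eq_foldr {X : Type*} (D : ℕ → X → X) (k : ℕ) (x : X) :
    (List.range k).foldr D x = sweep D k x := by
  induction k generalizing x with
  | zero => rfl
  | succ k ih => rw [List.range_succ, List.foldr_append]; exact ih _

/-- The relations of the `0`-Hecke monoid. -/
structure IsHecke {X : Type*} (D : ℕ → X → X) : Prop where
  idem : ∀ j x, D j (D j x) = D j x
  comm : ∀ i j x, i + 2 ≤ j → D i (D j x) = D j (D i x)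
  braid : ∀ j x, D j (D (j + 1) (D j x)) = D (j + 1) (D j (D (j + 1) x))

lemma isHecke_colT : IsHecke colT := ⟨colT_idem, fun _ _ f h => colT_comm h f, colT_braid⟩

lemma isHecke_rowT : IsHecke rowT := ⟨rowT_idem, fun _ _ f h => rowT_comm h f, rowT_braid⟩

namespace IsHecke

variable {X : Type*} {D : ℕ → X → X}

lemma sweep_far (H : IsHecke D) {j k : ℕ} (h : k + 1 ≤ j) (x : X) :
    D j (sweep D k x) = sweep D k (D j x) := by
  induction k generalizing x with
  | zero => rfl
  | succ k ih => rw [sweep, ih (by omega), sweep, H.comm k j x (by omega)]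

/-- The generator commutes past the far factors, and a braid move at the factors `j`, `j + 1` lowers
its index by one. -/
lemma sweep_shift (H : IsHecke D) {j k : ℕ} (h : j + 1 < k) (x : X) :
    D (j + 1) (sweep D k x) = sweep D k (D j x) := by
  induction k generalizing x with
  | zero => omega
  | succ k ih =>
    rcases Nat.lt_or_ge (j + 1) k with h' | h'
    · rw [sweep, ih h', sweep, H.comm j k x (by omega)]
    · obtain rfl : k = j + 1 := by omega
      simp only [sweep]
      rw [H.sweep_far (by omega), H.braid]

lemma sweep_zero (H : IsHecke D) {k : ℕ} (h : 0 < k) (x : X) :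
    D 0 (sweep D k x) = sweep D k x := by
  induction k generalizing x with
  | zero => omega
  | succ k ih =>
    rcases Nat.eq_zero_or_pos k with rfl | hk
    · exact H.idem 0 x
    · exact ih hk _

/-- Each pass lowers the index of the generator by one until the generator `D 0` is absorbed, so `j
+ 1` passes suffice. -/
lemma iterate_tight (H : IsHecke D) {j k e : ℕ} (hk : j < k) (he : j < e) (x : X) :
    D j ((sweep D k)^[e] x) = (sweep D k)^[e] x := by
  induction j generalizing e with
  | zero =>
    obtain ⟨e, rfl⟩ : ∃ e', e = e' + 1 := ⟨e - 1, by omega⟩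
    rw [Function.iterate_succ_apply', H.sweep_zero hk]
  | succ j ih =>
    obtain ⟨e, rfl⟩ : ∃ e', e = e' + 1 := ⟨e - 1, by omega⟩
    rw [Function.iterate_succ_apply', H.sweep_shift hk, ih (by omega) (by omega)]

/-- Each pass raises the index of a generator on its right by one. When the index reaches `k - 1`,
the generator meets the factor that acts first in the pass and disappears by idempotence. -/
lemma iterate_absorb (H : IsHecke D) {j k e : ℕ} (hk : j < k) (he : k ≤ e + j) (x : X) :
    (sweep D k)^[e] (D j x) = (sweep D k)^[e] x := by
  induction e generalizing j x with
  | zero => omega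
  | succ e ih =>
    rw [Function.iterate_succ_apply, Function.iterate_succ_apply]
    rcases Nat.lt_or_ge (j + 1) k with h | h
    · rw [← H.sweep_shift h, ih h (by omega)]
    · obtain rfl : k = j + 1 := by omega
      rw [sweep, H.idem, ← sweep]

end IsHecke

/-- A property preserved by all factors is preserved by `sweep`. -/
lemma sweep_induction {X : Type*} {D : ℕ → X → X} (p : X → Prop) {k : ℕ}
    (hD : ∀ j < k, ∀ x, p x → p (D j x)) {x : X} (hx : p x) : p (sweep D k x) := by
  induction k generalizing x with
  | zero => exact hx
  | succ k ih => exact ih (fun j hj => hD j (by omega)) (hD k (by omega) x hx)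

lemma iterate_sweep_induction {X : Type*} {D : ℕ → X → X} (p : X → Prop) {k : ℕ} (e : ℕ)
    (hD : ∀ j < k, ∀ x, p x → p (D j x)) {x : X} (hx : p x) : p ((sweep D k)^[e] x) := by
  induction e with
  | zero => exact hx
  | succ e ih => rw [Function.iterate_succ_apply']; exact sweep_induction p hD ih

end

/-! ### From elementary moves on arrays to the operations on integrals. -/

section

/-! Arrays and their integrals. -/

/-- The masses of an array, extended by zero. -/
def entry {n m : ℕ} (a : Arr n m) (p q : ℕ) : ℝ :=
  if h : p < n ∧ q < m then a ⟨p, h.1⟩ ⟨q, h.2⟩ else 0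

lemma entry_fin {n m : ℕ} (a : Arr n m) (p : Fin n) (q : Fin m) : entry a p q = a p q := by
  simp [entry]

lemma sum_range_ite {n : ℕ} (i : ℕ) {g : ℕ → ℝ} (hg : ∀ p, n ≤ p → g p = 0) :
    (∑ p ∈ Finset.range n, if p < i then g p else 0) = ∑ p ∈ Finset.range i, g p := by
  rw [← Finset.sum_filter]
  refine Finset.sum_subset (fun p hp => by simp at hp ⊢; omega) fun p hp hp' => hg p ?_
  simp at hp hp'
  by_contra h
  exact absurd (hp' (by omega)) (by omega)

lemma dint_eq_sum {n m : ℕ} (a : Arr n m) (i j : ℕ) :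
    dint a i j = ∑ p ∈ Finset.range i, ∑ q ∈ Finset.range j, entry a p q := by
  have h1 : dint a i j = ∑ p : Fin n, ∑ q : Fin m,
      (fun p q : ℕ => if p < i then (if q < j then entry a p q else 0) else 0) p q := by
    refine Finset.sum_congr rfl fun p _ => Finset.sum_congr rfl fun q _ => ?_
    simp only [entry_fin]
    by_cases h : (p : ℕ) < i <;> by_cases h' : (q : ℕ) < j <;> simp [h, h']
  rw [h1]
  have h2 : ∀ p : ℕ, (∑ q : Fin m,
      (fun p q : ℕ => if p < i then (if q < j then entry a p q else 0) else 0) p q) =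
      if p < i then ∑ q ∈ Finset.range j, entry a p q else 0 := by
    intro p
    split_ifs with h
    · rw [← sum_range_ite (n := m) j (g := fun q => entry a p q)
        (fun q hq => by simp [entry]; omega),
        ← Fin.sum_univ_eq_sum_range (fun q => if q < j then entry a p q else 0)]
      simp [h]
    · simp [h]
  simp only [h2]
  rw [Fin.sum_univ_eq_sum_range
    (fun p => if p < i then ∑ q ∈ Finset.range j, entry a p q else 0)]
  refine sum_range_ite i fun p hp => Finset.sum_eq_zero fun q _ => ?_
  simp [entry]; omega

variable {n m : ℕ}

lemma dint_zero_left (a : Arr n m) (j : ℕ) : dint a 0 j = 0 := by simp [dint_eq_sum]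

lemma dint_zero_right (a : Arr n m) (i : ℕ) : dint a i 0 = 0 := by simp [dint_eq_sum]

lemma dint_succ_left (a : Arr n m) (i j : ℕ) :
    dint a (i + 1) j = dint a i j + ∑ q ∈ Finset.range j, entry a i q := by
  simp [dint_eq_sum, Finset.sum_range_succ]

lemma dint_succ_right (a : Arr n m) (i j : ℕ) :
    dint a i (j + 1) = dint a i j + ∑ p ∈ Finset.range i, entry a p j := by
  simp [dint_eq_sum, Finset.sum_range_succ, Finset.sum_add_distrib]

lemma entry_eq (a : Arr n m) (i j : ℕ) :
    entry a i j = dint a (i + 1) (j + 1) - dint a i (j + 1) - dint a (i + 1) j + dint a i j := by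
  rw [dint_succ_left, dint_succ_left, Finset.sum_range_succ]; ring

lemma dint_injective : Function.Injective (dint : Arr n m → ℕ → ℕ → ℝ) := by
  intro a b h
  funext p q
  rw [← entry_fin a, ← entry_fin b, entry_eq, entry_eq, h]

lemma isIntegral_dint {a : Arr n m} : IsIntegral (dint a) ↔ ∀ i j, 0 ≤ a i j := by
  constructor
  · intro h p q
    rw [← entry_fin a, entry_eq]
    linarith [h.mass p q]
  · intro h
    refine ⟨dint_zero_left a, dint_zero_right a, fun i j => ?_⟩
    have : 0 ≤ entry a i j := by
      unfold entry; split_ifs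
      · exact h _ _
      · exact le_rfl
    rw [entry_eq] at this
    linarith

lemma dint_mem_iff (S : AddSubgroup ℝ) {a : Arr n m} :
    (∀ i j, dint a i j ∈ S) ↔ ∀ i j, a i j ∈ S := by
  constructor
  · intro h p q
    rw [← entry_fin a, entry_eq]
    exact S.add_mem (S.sub_mem (S.sub_mem (h _ _) (h _ _)) (h _ _)) (h _ _)
  · intro h i j
    rw [dint_eq_sum]
    refine S.sum_mem fun p _ => S.sum_mem fun q _ => ?_
    unfold entry; split_ifs
    · exact h _ _
    · exact S.zero_mem

lemma dint_transp (a : Arr n m) : dint (transp a) = fun i j => dint a j i := by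
  funext i j
  rw [dint_eq_sum, dint_eq_sum, Finset.sum_comm]
  refine Finset.sum_congr rfl fun p _ => Finset.sum_congr rfl fun q _ => ?_
  simp only [entry, transp]
  by_cases h : p < n <;> by_cases h' : q < m <;> simp [h, h']

lemma dint_of_le_left (a : Arr n m) {i : ℕ} (h : n ≤ i) (j : ℕ) : dint a i j = dint a n j := by
  induction i, h using Nat.le_induction with
  | base => rfl
  | succ i h ih =>
    rw [dint_succ_left, ih, Finset.sum_eq_zero, add_zero]
    intro q _
    simp [entry]; omega

lemma dint_of_le_right (a : Arr n m) {j : ℕ} (h : m ≤ j) (i : ℕ) : dint a i j = dint a i m := by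
  have := dint_of_le_left (transp a) h i
  rwa [dint_transp] at this

lemma sum_row (a : Arr n m) (q : Fin m) : ∑ p, a p q = dint a n (q + 1) - dint a n q := by
  rw [dint_succ_right, add_sub_cancel_left, ← Fin.sum_univ_eq_sum_range (fun p => entry a p q)]
  simp [entry_fin]

lemma dint_concat_left {n' : ℕ} (a : Arr n m) (b : Arr n' m) {i : ℕ} (h : i ≤ n) (j : ℕ) :
    dint (concat a b) i j = dint a i j := by
  rw [dint_eq_sum, dint_eq_sum]
  refine Finset.sum_congr rfl fun p hp => Finset.sum_congr rfl fun q _ => ?_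
  rw [Finset.mem_range] at hp
  have h1 : p < n := by omega
  have h2 : p < n + n' := by omega
  simp only [entry, h1, h2, true_and, concat]
  split_ifs
  · rw [show (⟨p, h2⟩ : Fin (n + n')) = Fin.castAdd n' ⟨p, h1⟩ from rfl, Fin.append_left]
  · rfl

lemma dint_concat_right {n' : ℕ} (a : Arr n m) (b : Arr n' m) (i j : ℕ) :
    dint (concat a b) (n + i) j = dint a n j + dint b i j := by
  rw [dint_eq_sum, Finset.sum_range_add, ← dint_eq_sum, dint_concat_left a b le_rfl,
    dint_eq_sum b]
  congr 1
  refine Finset.sum_congr rfl fun p hp => Finset.sum_congr rfl fun q _ => ?_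
  by_cases h : p < n' ∧ q < m
  · simp only [entry, h, concat, add_lt_add_iff_left, and_self, dif_pos]
    rw [show (⟨n + p, _⟩ : Fin (n + n')) = Fin.natAdd n ⟨p, h.1⟩ from rfl, Fin.append_right]
  · simp [entry, h]

/-! The elementary moves, in terms of the running maximum of the excesses. -/

/-- `max (0, B 0, …, B (i - 1))`. -/
def runMax (B : ℕ → ℝ) : ℕ → ℝ
  | 0 => 0
  | i + 1 => max (runMax B i) (B i)

lemma runMax_le_iff (B : ℕ → ℝ) (i : ℕ) (c : ℝ) :
    runMax B i ≤ c ↔ 0 ≤ c ∧ ∀ k < i, B k ≤ c := by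
  induction i with
  | zero => simp [runMax]
  | succ i ih =>
    rw [runMax, max_le_iff, ih]
    constructor
    · rintro ⟨⟨h1, h2⟩, h3⟩
      refine ⟨h1, fun k hk => ?_⟩
      rcases Nat.lt_succ_iff_lt_or_eq.1 hk with h | rfl
      · exact h2 k h
      · exact h3
    · rintro ⟨h1, h2⟩
      exact ⟨⟨h1, fun k hk => h2 k (by omega)⟩, h2 i (by omega)⟩

lemma le_runMax (B : ℕ → ℝ) {k i : ℕ} (h : k < i) : B k ≤ runMax B i :=
  ((runMax_le_iff B i _).1 le_rfl).2 k h

lemma runMax_mono (B : ℕ → ℝ) {k i : ℕ} (h : k ≤ i) : runMax B k ≤ runMax B i := by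
  rw [runMax_le_iff]
  exact ⟨((runMax_le_iff B i _).1 le_rfl).1, fun l hl => le_runMax B (by omega)⟩

/-- The index of the column which an elementary move affects. -/
def IsMoving (N : ℕ) (B : ℕ → ℝ) (p : ℕ) : Prop :=
  p < N ∧ runMax B p < B p ∧ ∀ k < N, B k ≤ B p

lemma IsMoving.unique {N : ℕ} {B : ℕ → ℝ} {p q : ℕ} (hp : IsMoving N B p) (hq : IsMoving N B q) :
    p = q := by
  rcases lt_trichotomy p q with h | h | h
  · linarith [hq.2.1, le_runMax B h, hp.2.2 q hq.1]
  · exact h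
  · linarith [hp.2.1, le_runMax B h, hq.2.2 p hp.1]

lemma exists_isMoving {N : ℕ} {B : ℕ → ℝ} (h : 0 < runMax B N) : ∃ p, IsMoving N B p := by
  classical
  have hex : ∃ i, runMax B i = runMax B N := ⟨N, rfl⟩
  obtain ⟨p, hp⟩ : ∃ p, Nat.find hex = p + 1 := by
    refine Nat.exists_eq_succ_of_ne_zero fun h0 => ?_
    have := Nat.find_spec hex
    rw [h0, runMax] at this
    linarith
  have hle : Nat.find hex ≤ N := Nat.find_min' hex rfl
  have hspec := Nat.find_spec hex
  rw [hp] at hspec hle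
  have hlt : runMax B p < runMax B N :=
    lt_of_le_of_ne (runMax_mono B (by omega)) (Nat.find_min hex (by omega))
  have hB : B p = runMax B N := by
    rw [runMax] at hspec
    rcases max_choice (runMax B p) (B p) with h' | h' <;> rw [h'] at hspec
    · linarith
    · exact hspec
  exact ⟨p, by omega, by linarith, fun k hk => by rw [hB]; exact le_runMax B hk⟩

open Classical in
/-- The mass which an elementary move takes out of the column `p`. -/
def moved (N : ℕ) (B : ℕ → ℝ) (p : ℕ) : ℝ :=
  if IsMoving N B p then min 1 (B p - runMax B p) else 0

/-- The mass which an elementary move takes out of the first `i` columns. -/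
def movedSum (N : ℕ) (B : ℕ → ℝ) (i : ℕ) : ℝ := ∑ p ∈ Finset.range i, moved N B p

lemma movedSum_eq_zero {N : ℕ} {B : ℕ → ℝ} (h : ∀ p, ¬ IsMoving N B p) (i : ℕ) :
    movedSum N B i = 0 := Finset.sum_eq_zero fun p _ => by simp [moved, h]

lemma movedSum_eq_ite {N : ℕ} {B : ℕ → ℝ} {p : ℕ} (h : IsMoving N B p) (i : ℕ) :
    movedSum N B i = if p < i then min 1 (B p - runMax B p) else 0 := by
  have : ∀ q, moved N B q = if q = p then min 1 (B p - runMax B p) else 0 := by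
    intro q
    by_cases hq : q = p
    · subst hq; simp [moved, h]
    · rw [if_neg hq, moved, if_neg fun h' => hq (h'.unique h)]
  simp [movedSum, this]

/-- The invariant behind stabilization: the running maximum plus the mass already moved stays
constant. A move of mass `t` in column `p` lowers the excess by `t` at `p` and by `2t` after it;
since the old maximum is at `p`, the new running maximum after `p` is `B p - t`. -/
lemma runMax_moved {N : ℕ} {B B' : ℕ → ℝ}
    (hB : ∀ i, B' i = B i - movedSum N B i - movedSum N B (i + 1)) {i : ℕ} (hi : i ≤ N) :
    runMax B' i = runMax B i - movedSum N B i := by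
  by_cases hex : ∃ p, IsMoving N B p
  · obtain ⟨p, hp⟩ := hex
    have hM := movedSum_eq_ite hp
    set t := min 1 (B p - runMax B p) with ht
    have ht1 : 0 < t := lt_min one_pos (by linarith [hp.2.1])
    have ht2 : t ≤ B p - runMax B p := min_le_right _ _
    have key : ∀ i ≤ N, (i ≤ p → runMax B' i = runMax B i) ∧
        (p < i → runMax B i = B p ∧ runMax B' i = B p - t) := by
      intro i
      induction i with
      | zero => intro _; exact ⟨fun _ => rfl, fun h => by omega⟩
      | succ i ih =>
        intro hi
        obtain ⟨h1, h2⟩ := ih (by omega)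
        refine ⟨fun h => ?_, fun h => ?_⟩
        · rw [runMax, runMax, h1 (by omega), hB, hM, hM, if_neg (by omega), if_neg (by omega),
            sub_zero, sub_zero]
        · rw [runMax, runMax, hB, hM, hM, if_pos h]
          rcases Nat.lt_succ_iff_lt_or_eq.1 h with h' | rfl
          · obtain ⟨h3, h4⟩ := h2 h'
            have := hp.2.2 i (by omega)
            rw [h3, h4, if_pos h', max_eq_left this, max_eq_left (by linarith)]
            exact ⟨rfl, rfl⟩
          · rw [if_neg (lt_irrefl _), h1 le_rfl, max_eq_right hp.2.1.le, sub_zero,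
              max_eq_right (by linarith)]
            exact ⟨rfl, rfl⟩
    rw [hM]
    split_ifs with h
    · rw [((key i hi).2 h).1, ((key i hi).2 h).2]
    · rw [(key i hi).1 (by omega), sub_zero]
  · push Not at hex
    have : B' = B := by
      funext i; rw [hB, movedSum_eq_zero hex, movedSum_eq_zero hex, sub_zero, sub_zero]
    rw [this, movedSum_eq_zero hex, sub_zero]

/-- The number of elementary moves before stabilization. -/
def moveCount (N : ℕ) (B : ℕ → ℝ) : ℕ :=
  ∑ p ∈ Finset.range N, ⌈runMax B (p + 1) - runMax B p⌉₊

/-- A move takes from the jump of the running maximum at `p` either a full unit or everything that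
is left, so its rounded-up value drops; the other jumps do not grow. -/
lemma moveCount_lt {N : ℕ} {B B' : ℕ → ℝ}
    (hB : ∀ i, B' i = B i - movedSum N B i - movedSum N B (i + 1)) {p : ℕ} (hp : IsMoving N B p) :
    moveCount N B' < moveCount N B := by
  have hM := movedSum_eq_ite hp
  refine Finset.sum_lt_sum (fun q hq => ?_) ⟨p, Finset.mem_range.2 hp.1, ?_⟩
  · rw [Finset.mem_range] at hq
    refine Nat.ceil_le_ceil ?_
    rw [runMax_moved hB (by omega), runMax_moved hB (by omega)]
    have : movedSum N B q ≤ movedSum N B (q + 1) := by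
      rw [hM, hM]
      split_ifs with h1 h2 h2
      · exact le_rfl
      · omega
      · exact le_min zero_le_one (by linarith [hp.2.1])
      · exact le_rfl
    linarith
  · have hp1 := hp.1
    rw [runMax_moved hB (by omega), runMax_moved hB (by omega), hM, hM, if_pos (by omega),
      if_neg (lt_irrefl _), runMax, max_eq_right hp.2.1.le]
    have hx : 0 < B p - runMax B p := by linarith [hp.2.1]
    have e : B p - min 1 (B p - runMax B p) - (runMax B p - 0) =
      (B p - runMax B p) - min 1 (B p - runMax B p) := by ring
    rw [e]
    rcases le_total 1 (B p - runMax B p) with h | h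
    · rw [min_eq_left h, Nat.ceil_sub_one]
      have : 0 < ⌈B p - runMax B p⌉₊ := Nat.ceil_pos.2 hx
      omega
    · rw [min_eq_right h, sub_self, Nat.ceil_zero]
      exact Nat.ceil_pos.2 hx

/-- The excess of the row `j + 1` over the row `j`, in terms of the integral. -/
def excessOf (f : ℕ → ℕ → ℝ) (j i : ℕ) : ℝ :=
  f (i + 1) (j + 2) - f (i + 1) (j + 1) - f i (j + 1) + f i j

/-- Unrolling the recurrence of `upd` gives a running maximum; this ties it to the rule for
elementary moves. -/
lemma rowT_line_eq (f : ℕ → ℕ → ℝ) (j i : ℕ) :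
    rowT j f i (j + 1) = f i (j + 1) + runMax (excessOf f j) i := by
  rw [rowT_line]
  induction i with
  | zero => simp [runMax]
  | succ i ih =>
    rw [upd_succ, ih, runMax, excessOf, ← max_add_add_left, ← max_sub_sub_right]
    congr 1 <;> ring

lemma sum_filter_fin (g : ℕ → ℝ) (hg : ∀ p, n ≤ p → g p = 0) (i : ℕ) :
    ∑ k ∈ Finset.univ.filter (fun k : Fin n => (k : ℕ) < i), g k =
      ∑ p ∈ Finset.range i, g p := by
  rw [Finset.sum_filter, Fin.sum_univ_eq_sum_range (fun k => if k < i then g k else 0)]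
  exact sum_range_ite i hg

lemma excess_eq (a : Arr n m) {j : ℕ} (h : j + 1 < m) (i : Fin n) :
    excess ⟨j, Nat.lt_of_succ_lt h⟩ ⟨j + 1, h⟩ a i = excessOf (dint a) j i := by
  have hz : ∀ q p, n ≤ p → entry a p q = 0 := fun q p hp => by simp [entry]; omega
  have h1 := sum_filter_fin (fun p => entry a p (j + 1)) (hz _) (i + 1)
  have h2 := sum_filter_fin (fun p => entry a p j) (hz _) i
  have e1 : ∀ k : Fin n, entry a k (j + 1) = a k ⟨j + 1, h⟩ := fun k => entry_fin a k ⟨j + 1, h⟩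
  have e2 : ∀ k : Fin n, entry a k j = a k ⟨j, Nat.lt_of_succ_lt h⟩ :=
    fun k => entry_fin a k ⟨j, Nat.lt_of_succ_lt h⟩
  simp only [e1, Nat.lt_succ_iff, Fin.val_fin_le] at h1
  simp only [e2, Fin.val_fin_lt] at h2
  rw [excess, h1, h2, excessOf, dint_succ_right a (i + 1) (j + 1), dint_succ_right a i j]
  ring

lemma prevMax_eq (a : Arr n m) {j : ℕ} (h : j + 1 < m) (i : Fin n) :
    prevMax ⟨j, Nat.lt_of_succ_lt h⟩ ⟨j + 1, h⟩ a i = runMax (excessOf (dint a) j) i := by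
  refine eq_of_forall_ge_iff fun c => ?_
  rw [prevMax, Finset.fold_max_le, runMax_le_iff]
  simp only [Finset.mem_filter, Finset.mem_univ, true_and, excess_eq]
  refine and_congr_right fun _ => ⟨fun H k hk => H ⟨k, by omega⟩ hk, fun H k hk => H k hk⟩

lemma moveAmount_eq (a : Arr n m) {j : ℕ} (h : j + 1 < m) (i : Fin n) :
    moveAmount ⟨j, Nat.lt_of_succ_lt h⟩ ⟨j + 1, h⟩ a i = moved n (excessOf (dint a) j) i := by
  simp only [moveAmount, moved, IsMoving, prevMax_eq, excess_eq]
  congr 1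
  simp only [i.2, true_and, eq_iff_iff]
  refine and_congr_right fun _ => ⟨fun H k hk => H ⟨k, hk⟩, fun H k => H k k.2⟩

lemma entry_opD (a : Arr n m) {j : ℕ} (h : j + 1 < m) (p q : ℕ) :
    entry (opD j a) p q = entry a p q + (if q = j then moved n (excessOf (dint a) j) p else 0)
      - (if q = j + 1 then moved n (excessOf (dint a) j) p else 0) := by
  by_cases hp : p < n
  · by_cases hq : q < m
    · rw [entry, dif_pos ⟨hp, hq⟩, entry, dif_pos ⟨hp, hq⟩, opD, dif_pos h, moveDown,
        moveAmount_eq]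
      simp only [Fin.mk.injEq]
      split_ifs <;> first | omega | ring
    · rw [entry, dif_neg (by omega), entry, dif_neg (by omega), if_neg (by omega),
        if_neg (by omega)]
      ring
  · rw [entry, dif_neg (by omega), entry, dif_neg (by omega)]
    have hz : moved n (excessOf (dint a) j) p = 0 := if_neg fun h' => hp h'.1
    simp [hz]

lemma dint_opD (a : Arr n m) {j : ℕ} (h : j + 1 < m) (i k : ℕ) :
    dint (opD j a) i k =
      dint a i k + if k = j + 1 then movedSum n (excessOf (dint a) j) i else 0 := by
  simp only [dint_eq_sum, entry_opD a h, Finset.sum_add_distrib, Finset.sum_sub_distrib,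
    Finset.sum_ite_eq', Finset.mem_range]
  rw [add_sub_assoc, ← Finset.sum_sub_distrib]
  congr 1
  by_cases hk : k = j + 1
  · subst hk
    simp [movedSum]
  · rw [if_neg hk]
    refine Finset.sum_eq_zero fun p _ => ?_
    by_cases h1 : j < k
    · rw [if_pos h1, if_pos (by omega), sub_self]
    · rw [if_neg h1, if_neg (by omega), sub_self]

lemma excessOf_opD (a : Arr n m) {j : ℕ} (h : j + 1 < m) (i : ℕ) :
    excessOf (dint (opD j a)) j i = excessOf (dint a) j i
      - movedSum n (excessOf (dint a) j) i - movedSum n (excessOf (dint a) j) (i + 1) := by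
  simp [excessOf, dint_opD a h]
  ring

lemma opD_of_le (a : Arr n m) {j : ℕ} (h : m ≤ j + 1) : opD j a = a := by
  rw [opD, dif_neg (by omega)]

lemma opD_eq_self (a : Arr n m) {j : ℕ} (h : j + 1 < m)
    (hm : ∀ p, ¬ IsMoving n (excessOf (dint a) j) p) : opD j a = a := by
  apply dint_injective
  funext i k
  rw [dint_opD a h, movedSum_eq_zero hm]
  simp

lemma not_isMoving_of_opD_eq {a : Arr n m} {j : ℕ} (h : j + 1 < m) (ha : opD j a = a) (p : ℕ) :
    ¬ IsMoving n (excessOf (dint a) j) p := by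
  intro hp
  have := dint_opD a h (p + 1) (j + 1)
  rw [ha, if_pos rfl, movedSum_eq_ite hp, if_pos (by omega)] at this
  have : 0 < min 1 (excessOf (dint a) j p - runMax (excessOf (dint a) j) p) :=
    lt_min one_pos (by linarith [hp.2.1])
  linarith

lemma exists_stable (j : ℕ) (a : Arr n m) : ∃ e, (opD j)^[e + 1] a = (opD j)^[e] a := by
  by_cases h : j + 1 < m
  · induction hc : moveCount n (excessOf (dint a) j) using Nat.strong_induction_on
      generalizing a with
    | _ c ih =>
      by_cases hm : ∃ p, IsMoving n (excessOf (dint a) j) p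
      · obtain ⟨p, hp⟩ := hm
        obtain ⟨e, he⟩ := ih _ (hc ▸ moveCount_lt (excessOf_opD a h) hp) (opD j a) rfl
        exact ⟨e + 1, he⟩
      · push Not at hm
        exact ⟨0, opD_eq_self a h hm⟩
  · exact ⟨0, opD_of_le a (by omega)⟩

lemma opD_boldDj (j : ℕ) (a : Arr n m) : opD j (boldDj j a) = boldDj j a := by
  have := Nat.sInf_mem (s := {e : ℕ | (opD j)^[e + 1] a = (opD j)^[e] a}) (exists_stable j a)
  rw [Set.mem_ofPred_eq, Function.iterate_succ_apply'] at this
  exact this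

lemma boldDj_of_opD_eq {j : ℕ} {a : Arr n m} (h : opD j a = a) : boldDj j a = a :=
  Function.iterate_fixed h _

lemma rowT_dint_opD (a : Arr n m) {j : ℕ} (h : j + 1 < m) {i : ℕ} (hi : i ≤ n) (k : ℕ) :
    rowT j (dint (opD j a)) i k = rowT j (dint a) i k := by
  by_cases hk : k = j + 1
  · subst hk
    rw [rowT_line_eq, rowT_line_eq, runMax_moved (excessOf_opD a h) hi, dint_opD a h,
      if_pos rfl]
    ring
  · rw [rowT_of_ne _ _ hk, rowT_of_ne _ _ hk, dint_opD a h, if_neg hk, add_zero]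

lemma rowT_dint_iterate (a : Arr n m) {j : ℕ} (h : j + 1 < m) {i : ℕ} (hi : i ≤ n) (k e : ℕ) :
    rowT j (dint ((opD j)^[e] a)) i k = rowT j (dint a) i k := by
  induction e generalizing a with
  | zero => rfl
  | succ e ih => rw [Function.iterate_succ_apply, ih, rowT_dint_opD a h hi]

lemma runMax_of_opD_eq {a : Arr n m} {j : ℕ} (h : j + 1 < m) (ha : opD j a = a) {i : ℕ}
    (hi : i ≤ n) : runMax (excessOf (dint a) j) i = 0 := by
  refine le_antisymm ?_ (runMax_mono _ (Nat.zero_le i))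
  by_contra hpos
  obtain ⟨p, hp⟩ := exists_isMoving (N := n) (B := excessOf (dint a) j)
    (by linarith [runMax_mono (excessOf (dint a) j) hi])
  exact not_isMoving_of_opD_eq h ha p hp

/-- `rowT` has the same value before and after every elementary move, and on a stable array it does
nothing, because the running maximum vanishes there. -/
lemma dint_boldDj_of_le (a : Arr n m) {j : ℕ} (h : j + 1 < m) {i : ℕ} (hi : i ≤ n) (k : ℕ) :
    dint (boldDj j a) i k = rowT j (dint a) i k := by
  have h2 : rowT j (dint (boldDj j a)) i k = rowT j (dint a) i k := rowT_dint_iterate a h hi k _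
  rw [← h2]
  by_cases hk : k = j + 1
  · rw [hk, rowT_line_eq, runMax_of_opD_eq h (opD_boldDj j a) hi, add_zero]
  · rw [rowT_of_ne _ _ hk]

/-- `rowT` acts on the whole quadrant, beyond the columns of the array. Nonnegative mass in the last
column ensures that no new maximum appears there. -/
lemma runMax_excessOf_of_le {a : Arr n m} (ha : ∀ i j, 0 ≤ a i j) (j : ℕ) {i : ℕ} (hi : n ≤ i) :
    runMax (excessOf (dint a) j) i = runMax (excessOf (dint a) j) n := by
  have hf := isIntegral_dint.2 ha
  have hn : excessOf (dint a) j n ≤ runMax (excessOf (dint a) j) n := by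
    rcases Nat.eq_zero_or_pos n with h0 | h0
    · simp only [excessOf]
      rw [dint_of_le_left a (i := n + 1) (by omega), dint_of_le_left a (i := n + 1) (by omega)]
      subst h0
      simp [runMax, dint_zero_left]
    · obtain ⟨N, hN⟩ : ∃ N, n = N + 1 := ⟨n - 1, by omega⟩
      refine le_trans ?_ (le_runMax _ (show N < n by omega))
      simp only [excessOf]
      rw [dint_of_le_left a (i := n + 1) (by omega), dint_of_le_left a (i := n + 1) (by omega),
        ← hN]
      have := hf.mass N j
      rw [← hN] at this
      linarith
  induction i, hi using Nat.le_induction with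
  | base => rfl
  | succ i hi ih =>
    rw [runMax, ih, max_eq_left]
    refine le_of_eq_of_le ?_ hn
    simp only [excessOf]
    rw [dint_of_le_left a hi, dint_of_le_left a hi, dint_of_le_left a (i := i + 1) (by omega),
      dint_of_le_left a (i := i + 1) (by omega), dint_of_le_left a (i := n + 1) (by omega),
      dint_of_le_left a (i := n + 1) (by omega)]

lemma rowT_dint_of_le {a : Arr n m} (ha : ∀ i j, 0 ≤ a i j) {j : ℕ} (h : m ≤ j + 1) :
    rowT j (dint a) = dint a := by
  have hf := isIntegral_dint.2 ha
  rw [rowT_eq_self_iff]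
  intro i
  rw [dint_of_le_right a (j := j + 2) (by omega), dint_of_le_right a (j := j + 1) h,
    dint_of_le_right a (j := j + 1) h]
  have := hf.mono_right i j
  rw [dint_of_le_right a (j := j + 1) h] at this
  linarith

lemma dint_boldDj {a : Arr n m} (ha : ∀ i j, 0 ≤ a i j) (j : ℕ) :
    dint (boldDj j a) = rowT j (dint a) := by
  by_cases h : j + 1 < m
  · funext i k
    rcases le_total i n with hi | hi
    · exact dint_boldDj_of_le a h hi k
    · rw [dint_of_le_left _ hi, dint_boldDj_of_le a h le_rfl]
      by_cases hk : k = j + 1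
      · rw [hk, rowT_line_eq, rowT_line_eq, runMax_excessOf_of_le ha j hi, dint_of_le_left a hi]
      · rw [rowT_of_ne _ _ hk, rowT_of_ne _ _ hk, dint_of_le_left a hi]
  · rw [rowT_dint_of_le ha (by omega), boldDj_of_opD_eq (opD_of_le a (by omega))]

lemma boldDj_nonneg {a : Arr n m} (ha : ∀ i j, 0 ≤ a i j) (j : ℕ) :
    ∀ p q, 0 ≤ boldDj j a p q := by
  rw [← isIntegral_dint, dint_boldDj ha]
  exact (isIntegral_dint.2 ha).map_rowT j

lemma sweep_boldDj {a : Arr n m} (ha : ∀ i j, 0 ≤ a i j) (k : ℕ) :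
    (∀ p q, 0 ≤ sweep boldDj k a p q) ∧ dint (sweep boldDj k a) = sweep rowT k (dint a) := by
  induction k generalizing a with
  | zero => exact ⟨ha, rfl⟩
  | succ k ih =>
    obtain ⟨h1, h2⟩ := ih (boldDj_nonneg ha k)
    exact ⟨h1, by rw [sweep, h2, dint_boldDj ha, sweep]⟩

lemma passD_eq_sweep (a : Arr n m) : passD a = sweep boldDj (m - 1) a := sweep_eq_foldr _ _ _

lemma iterate_passD {a : Arr n m} (ha : ∀ i j, 0 ≤ a i j) (e : ℕ) :
    (∀ p q, 0 ≤ passD^[e] a p q) ∧ dint (passD^[e] a) = (sweep rowT (m - 1))^[e] (dint a) := by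
  induction e with
  | zero => exact ⟨ha, rfl⟩
  | succ e ih =>
    rw [Function.iterate_succ_apply', Function.iterate_succ_apply', ← ih.2, passD_eq_sweep]
    exact sweep_boldDj ih.1 _

lemma boldD_nonneg {a : Arr n m} (ha : ∀ i j, 0 ≤ a i j) : ∀ p q, 0 ≤ boldD a p q :=
  (iterate_passD ha m).1

/-- The condensation, in terms of integrals. -/
lemma dint_boldD {a : Arr n m} (ha : ∀ i j, 0 ≤ a i j) :
    dint (boldD a) = (sweep rowT (m - 1))^[m] (dint a) := (iterate_passD ha m).2

lemma opD_eq_self_iff {a : Arr n m} (ha : ∀ i j, 0 ≤ a i j) {j : ℕ} :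
    opD j a = a ↔ rowT j (dint a) = dint a := by
  constructor
  · intro h
    rw [← dint_boldDj ha, boldDj_of_opD_eq h]
  · intro h
    have : boldDj j a = a := dint_injective (by rw [dint_boldDj ha, h])
    rw [← this, opD_boldDj]

lemma isDTight_iff {a : Arr n m} (ha : ∀ i j, 0 ≤ a i j) :
    IsDTight a ↔ ∀ j, rowT j (dint a) = dint a := forall_congr' fun _ => opD_eq_self_iff ha

lemma isLTight_iff {a : Arr n m} (ha : ∀ i j, 0 ≤ a i j) :
    IsLTight a ↔ ∀ s, colT s (dint a) = dint a := by
  rw [IsLTight, isDTight_iff (a := transp a) fun i j => ha j i]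
  refine forall_congr' fun s => ?_
  rw [dint_transp, rowT_eq_self_iff, colT_eq_self_iff]

lemma isDTight_boldD {a : Arr n m} (ha : ∀ i j, 0 ≤ a i j) : IsDTight (boldD a) := by
  intro j
  by_cases h : j + 1 < m
  · rw [opD_eq_self_iff (boldD_nonneg ha), dint_boldD ha]
    exact isHecke_rowT.iterate_tight (by omega) (by omega) _
  · exact opD_of_le _ (by omega)

lemma boldD_of_isDTight {a : Arr n m} (h : IsDTight a) : boldD a = a := by
  refine Function.iterate_fixed ?_ _
  rw [passD_eq_sweep]
  exact sweep_induction (D := boldDj) (· = a) (fun j _ x hx => by rw [hx, boldDj_of_opD_eq (h j)]) rfl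

/-- The vector of shapes as increments of an integral. -/
lemma shape_eq (a : Arr n m) (k : Fin m) :
    shape a k = dint (boldD a) n (k + 1) - dint (boldD a) n k := sum_row _ _

lemma sweep_swap (k : ℕ) (f : ℕ → ℕ → ℝ) :
    (fun i j => sweep rowT k (fun i j => f j i) j i) = sweep colT k f := by
  induction k generalizing f with
  | zero => rfl
  | succ k ih => exact ih (colT k f)

lemma boldL_nonneg {a : Arr n m} (ha : ∀ i j, 0 ≤ a i j) : ∀ p q, 0 ≤ boldL a p q :=
  fun p q => boldD_nonneg (a := transp a) (fun i j => ha j i) q p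

/-- The condensation to the left, in terms of integrals. -/
lemma dint_boldL {a : Arr n m} (ha : ∀ i j, 0 ≤ a i j) :
    dint (boldL a) = (sweep colT (n - 1))^[n] (dint a) := by
  rw [boldL, dint_transp, dint_boldD (a := transp a) fun i j => ha j i, dint_transp]
  generalize dint a = f
  generalize n = e
  have : ∀ d, (fun i j => (sweep rowT (e - 1))^[d] (fun i j => f j i) j i) =
      (sweep colT (e - 1))^[d] f := by
    intro d
    induction d with
    | zero => rfl
    | succ d ih =>
      rw [Function.iterate_succ_apply', Function.iterate_succ_apply', ← ih, ← sweep_swap]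
  exact this e

lemma isLTight_boldL {a : Arr n m} (ha : ∀ i j, 0 ≤ a i j) : IsLTight (boldL a) :=
  isDTight_boldD (a := transp a) fun i j => ha j i

end

/-! ### Standard pairs and discrete concave functions. -/

section

variable {n m : ℕ}

lemma dint_ext {a b : Arr n m} (h : ∀ i ≤ n, ∀ j ≤ m, dint a i j = dint b i j) : a = b := by
  funext p q
  rw [← entry_fin a, ← entry_fin b, entry_eq, entry_eq, h _ (by omega) _ (by omega),
    h _ (by omega) _ (by omega), h _ (by omega) _ (by omega), h _ (by omega) _ (by omega)]

/-- The array with a given integral. -/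
def arrOf (n m : ℕ) (h : ℕ → ℕ → ℝ) : Arr n m := fun p q =>
  h (p + 1) (q + 1) - h p (q + 1) - h (p + 1) q + h p q

lemma dint_arrOf {h : ℕ → ℕ → ℝ} (h0 : ∀ j, h 0 j = 0) (h1 : ∀ i, h i 0 = 0) {i j : ℕ}
    (hi : i ≤ n) (hj : j ≤ m) : dint (arrOf n m h) i j = h i j := by
  induction i generalizing j with
  | zero => rw [dint_zero_left, h0]
  | succ i ih =>
    induction j with
    | zero => rw [dint_zero_right, h1]
    | succ j ihj =>
      have e1 := entry_eq (arrOf n m h) i j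
      have e2 : entry (arrOf n m h) i j =
          h (i + 1) (j + 1) - h i (j + 1) - h (i + 1) j + h i j :=
        entry_fin (arrOf n m h) ⟨i, hi⟩ ⟨j, hj⟩
      rw [ih (by omega) (by omega), ih (by omega) (by omega), ihj (by omega)] at e1
      linarith

lemma isDTight_iff_of_lt {a : Arr n m} (ha : ∀ i j, 0 ≤ a i j) :
    IsDTight a ↔ ∀ i j, i < n → j + 2 ≤ m →
      dint a (i + 1) (j + 2) + dint a i j ≤ dint a (i + 1) (j + 1) + dint a i (j + 1) := by
  rw [isDTight_iff ha]
  simp only [rowT_eq_self_iff]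
  refine ⟨fun h i j _ _ => h j i, fun h j i => ?_⟩
  have hf := isIntegral_dint.2 ha
  rcases Nat.lt_or_ge m (j + 2) with hj | hj
  · rw [dint_of_le_right a (j := j + 2) (by omega), dint_of_le_right a (j := j + 1) (by omega),
      dint_of_le_right a (j := j + 1) (by omega)]
    have := hf.mono_right i j
    rw [dint_of_le_right a (j := j + 1) (by omega)] at this
    linarith
  · rcases Nat.lt_or_ge i n with hi | hi
    · exact h i j hi hj
    · simp only [dint_of_le_left a hi, dint_of_le_left a (show n ≤ i + 1 by omega)]
      rcases Nat.eq_zero_or_pos n with h0 | h0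
      · subst h0; simp [dint_zero_left]
      · obtain ⟨N, hN⟩ : ∃ N, n = N + 1 := ⟨n - 1, by omega⟩
        have h1 := h N j (by omega) hj
        have h2 := hf.mass N j
        rw [← hN] at h1 h2
        linarith

lemma isLTight_iff_of_lt {a : Arr n m} (ha : ∀ i j, 0 ≤ a i j) :
    IsLTight a ↔ ∀ s k, s + 2 ≤ n → k < m →
      dint a (s + 2) (k + 1) + dint a s k ≤ dint a (s + 1) (k + 1) + dint a (s + 1) k := by
  rw [IsLTight, isDTight_iff_of_lt (a := transp a) fun i j => ha j i, dint_transp]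
  exact ⟨fun h s k h1 h2 => h k s h2 h1, fun h k s h1 h2 => h s k h2 h1⟩

lemma concat_nonneg {n' : ℕ} {a : Arr n m} {b : Arr n' m} (ha : ∀ i j, 0 ≤ a i j)
    (hb : ∀ i j, 0 ≤ b i j) : ∀ i j, 0 ≤ concat a b i j := by
  intro i j
  refine Fin.addCases (fun i => ?_) (fun i => ?_) i
  · rw [concat, Fin.append_left]; exact ha i j
  · rw [concat, Fin.append_right]; exact hb i j

/-- The array `a` acts on the inequalities for `b` only through the constant in parentheses, the
difference of its row sums in two consecutive rows. -/
lemma isDTight_concat_iff {n' : ℕ} {a : Arr n m} {b : Arr n' m} (ha : ∀ i j, 0 ≤ a i j)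
    (hb : ∀ i j, 0 ≤ b i j) : IsDTight (concat a b) ↔ IsDTight a ∧ ∀ j i,
      dint b (i + 1) (j + 2) + dint b i j ≤ dint b (i + 1) (j + 1) + dint b i (j + 1)
        + (2 * dint a n (j + 1) - dint a n (j + 2) - dint a n j) := by
  rw [isDTight_iff (concat_nonneg ha hb)]
  simp only [rowT_eq_self_iff]
  constructor
  · intro h
    constructor
    · rw [isDTight_iff_of_lt ha]
      intro i j hi _
      have := h j i
      rwa [dint_concat_left _ _ (by omega), dint_concat_left _ _ (by omega),
        dint_concat_left _ _ (by omega), dint_concat_left _ _ (by omega)] at this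
    · intro j i
      have := h j (n + i)
      rw [add_assoc] at this
      simp only [dint_concat_right] at this
      linarith
  · rintro ⟨h1, h2⟩ j i
    rw [isDTight_iff ha] at h1
    simp only [rowT_eq_self_iff] at h1
    rcases Nat.lt_or_ge i n with hi | hi
    · rw [dint_concat_left _ _ (by omega), dint_concat_left _ _ (by omega),
        dint_concat_left _ _ (by omega), dint_concat_left _ _ (by omega)]
      exact h1 j i
    · obtain ⟨d, rfl⟩ := Nat.exists_eq_add_of_le hi
      rw [add_assoc]
      simp only [dint_concat_right]
      linarith [h2 j d]

lemma shape_of_isDTight {a : Arr n m} (h : IsDTight a) (k : Fin m) :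
    shape a k = dint a n (k + 1) - dint a n k := by
  rw [shape_eq, boldD_of_isDTight h]

/-- The condensation preserves the column sums. -/
lemma dint_boldD_top {a : Arr n m} (ha : ∀ i j, 0 ≤ a i j) (i : ℕ) {j : ℕ} (hj : m ≤ j) :
    dint (boldD a) i j = dint a i j := by
  rw [dint_boldD ha]
  refine iterate_sweep_induction (fun f : ℕ → ℕ → ℝ => f i j = dint a i j) m (fun r hr f hf => ?_) rfl
  rw [rowT_of_ne _ _ (by omega)]; exact hf

lemma dint_boldL_right {a : Arr n m} (ha : ∀ i j, 0 ≤ a i j) {i : ℕ} (hi : n ≤ i) (j : ℕ) :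
    dint (boldL a) i j = dint a i j := by
  have := dint_boldD_top (a := transp a) (fun i j => ha j i) j hi
  rw [boldL, dint_transp]
  simp only [this, dint_transp]

lemma dint_boldD_slack {a : Arr n m} (ha : ∀ i j, 0 ≤ a i j) {s : ℕ} {κ : ℝ}
    (h : ∀ k, dint a (s + 2) (k + 1) + dint a s k ≤
      dint a (s + 1) (k + 1) + dint a (s + 1) k + κ) (k : ℕ) :
    dint (boldD a) (s + 2) (k + 1) + dint (boldD a) s k ≤
      dint (boldD a) (s + 1) (k + 1) + dint (boldD a) (s + 1) k + κ := by
  rw [dint_boldD ha]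
  exact iterate_sweep_induction
    (fun f : ℕ → ℕ → ℝ => ∀ k, f (s + 2) (k + 1) + f s k ≤ f (s + 1) (k + 1) + f (s + 1) k + κ) m
    (fun j _ f hf => rowT_slack j hf) h k

lemma dint_boldL_slack {a : Arr n m} (ha : ∀ i j, 0 ≤ a i j) {j : ℕ} {κ : ℝ}
    (h : ∀ i, dint a (i + 1) (j + 2) + dint a i j ≤
      dint a (i + 1) (j + 1) + dint a i (j + 1) + κ) (i : ℕ) :
    dint (boldL a) (i + 1) (j + 2) + dint (boldL a) i j ≤
      dint (boldL a) (i + 1) (j + 1) + dint (boldL a) i (j + 1) + κ := by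
  rw [dint_boldL ha]
  exact iterate_sweep_induction
    (fun f : ℕ → ℕ → ℝ => ∀ i, f (i + 1) (j + 2) + f i j ≤ f (i + 1) (j + 1) + f i (j + 1) + κ) n
    (fun s _ f hf => colT_slack s hf) h i

lemma isLTight_boldD_of {a : Arr n m} (ha : ∀ i j, 0 ≤ a i j) (h : IsLTight a) :
    IsLTight (boldD a) := by
  rw [isLTight_iff (boldD_nonneg ha)]
  rw [isLTight_iff ha] at h
  simp only [colT_eq_self_iff] at h ⊢
  intro s k
  have := dint_boldD_slack ha (s := s) (κ := 0) (fun k => by linarith [h s k]) k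
  linarith

lemma isDTight_boldL_of {a : Arr n m} (ha : ∀ i j, 0 ≤ a i j) (h : IsDTight a) :
    IsDTight (boldL a) := isLTight_boldD_of (a := transp a) (fun i j => ha j i) h

lemma IsLTight.dint_eq {a : Arr n m} (ha : ∀ i j, 0 ≤ a i j) (h : IsLTight a) {i j : ℕ}
    (hj : j ≤ i) : dint a i j = dint a j j :=
  (isIntegral_dint.2 ha).eq_diag (M := i) (fun s _ => (isLTight_iff ha).1 h s) hj le_rfl

lemma IsDTight.dint_eq {a : Arr n m} (ha : ∀ i j, 0 ≤ a i j) (h : IsDTight a) {i j : ℕ}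
    (hj : i ≤ j) : dint a i j = dint a i i := by
  have := IsLTight.dint_eq (a := transp a) (fun i j => ha j i) h hj
  simpa [dint_transp] using this

/-- The shape of an `𝐋`-tight array is given by its column sums. -/
lemma shape_of_isLTight {b : Arr n n} (hb : ∀ i j, 0 ≤ b i j) (h : IsLTight b) (k : Fin n) :
    shape b k = dint b (k + 1) n - dint b k n := by
  have h0 := boldD_nonneg hb
  -- `boldD b` is tight in both directions, so its integral agrees at `(n, k)`, `(k, k)` and `(k,
  -- n)`; the last value is unchanged by the condensation.
  have key : ∀ k ≤ n, dint (boldD b) n k = dint b k n := by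
    intro k hk
    rw [(isLTight_boldD_of hb h).dint_eq h0 hk, ← (isDTight_boldD hb).dint_eq h0 hk,
      dint_boldD_top hb _ le_rfl]
  rw [shape_eq, key _ (by omega), key _ (by omega)]

variable (S : AddSubgroup ℝ)

lemma mem_SP_iff {α β γ : Fin n → ℝ} {a b : Arr n n} : (a, b) ∈ SP (S : Set ℝ) α β γ ↔
    IsStandardPair a b ∧ (∀ k : Fin n, dint a n (k + 1) - dint a n k = α k) ∧
    (∀ k : Fin n, dint b (k + 1) n - dint b k n = β k) ∧
    (∀ k : Fin n, dint a n (k + 1) + dint b n (k + 1) - (dint a n k + dint b n k) = γ k) ∧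
    (∀ i j, a i j ∈ S) ∧ (∀ i j, b i j ∈ S) := by
  refine and_congr_right fun h => ?_
  obtain ⟨ha, hb, hla, hlb, hd⟩ := h
  have hda := ((isDTight_concat_iff ha hb).1 hd).1
  simp only [funext_iff, shape_of_isDTight hda, shape_of_isDTight hd, shape_of_isLTight hb hlb,
    dint_concat_right, SetLike.mem_coe]

/-- In a standard pair the first array is tight in both directions, hence diagonal. -/
lemma dint_eq_min {a b : Arr n n} (h : IsStandardPair a b) {i j : ℕ} (hi : i ≤ n) (hj : j ≤ n) :
    dint a i j = dint a n (min i j) := by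
  obtain ⟨ha, hb, hla, -, hd⟩ := h
  have hda := ((isDTight_concat_iff ha hb).1 hd).1
  rcases le_total i j with hij | hij
  · rw [min_eq_left hij, hda.dint_eq ha hij, hla.dint_eq ha hi]
  · rw [min_eq_right hij, hla.dint_eq ha hij, hla.dint_eq ha hj]

lemma toDC_apply (x : Arr n n × Arr n n) (i j : ℕ) :
    toDC x i j = if i ≤ j ∧ j ≤ n then dint x.1 n j + dint x.2 i j else 0 := by
  simp only [toDC, onGrid, dint_concat_right]

lemma toDC_of_le (x : Arr n n × Arr n n) {i j : ℕ} (hij : i ≤ j) (hj : j ≤ n) :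
    toDC x i j = dint x.1 n j + dint x.2 i j := by
  rw [toDC_apply, if_pos ⟨hij, hj⟩]

/-- The three kinds of rhombus inequalities come, in order, from the nonnegativity of `b`, the
tightness of `a ⊗ b` downwards and the tightness of `b` to the left. -/
lemma mapsTo_toDC (α β γ : Fin n → ℝ) :
    Set.MapsTo toDC (SP (S : Set ℝ) α β γ) (DC (S : Set ℝ) α β γ) := by
  rintro ⟨a, b⟩ hx
  rw [mem_SP_iff] at hx
  obtain ⟨⟨ha, hb, hla, hlb, hd⟩, h1, h2, h3, h4, h5⟩ := hx
  have hf := isIntegral_dint.2 hb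
  have hD := ((isDTight_concat_iff ha hb).1 hd).2
  have hL := (isLTight_iff hb).1 hlb
  simp only [colT_eq_self_iff] at hL
  refine ⟨fun i j h => ?_, ?_, ⟨fun i j hi hj => ?_, fun i j hi hj => ?_, fun i j hi hj => ?_⟩,
    fun k => ?_, fun k => ?_, fun k => ?_, fun i j => ?_⟩
  · rw [toDC_apply, if_neg h]
  · rw [toDC_of_le _ le_rfl (by omega)]; simp [dint_zero_right]
  · rw [toDC_of_le _ (by omega) (by omega), toDC_of_le _ (by omega) (by omega),
      toDC_of_le _ (by omega) (by omega), toDC_of_le _ (by omega) (by omega)]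
    linarith [hf.mass i j]
  · rw [toDC_of_le _ (by omega) (by omega), toDC_of_le _ (by omega) (by omega),
      toDC_of_le _ (by omega) (by omega), toDC_of_le _ (by omega) (by omega)]
    linarith [hD j i]
  · rw [toDC_of_le _ (by omega) (by omega), toDC_of_le _ (by omega) (by omega),
      toDC_of_le _ (by omega) (by omega), toDC_of_le _ (by omega) (by omega)]
    linarith [hL i j]
  · rw [toDC_of_le _ (by omega) (by omega), toDC_of_le _ (by omega) (by omega), ← h1]
    simp [dint_zero_left]
  · rw [toDC_of_le _ (by omega) (by omega), toDC_of_le _ (by omega) (by omega), ← h2]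
    ring
  · rw [toDC_of_le _ (by omega) (by omega), toDC_of_le _ (by omega) (by omega), ← h3]
    rw [← hlb.dint_eq hb (i := n) (j := k + 1) (by omega),
      ← hlb.dint_eq hb (i := n) (j := k) (by omega)]
  · rw [toDC_apply]
    split_ifs
    · exact S.add_mem ((dint_mem_iff S).2 h4 _ _) ((dint_mem_iff S).2 h5 _ _)
    · exact S.zero_mem

/-- A standard pair is determined by its discrete concave function. -/
lemma toDC_injOn : Set.InjOn toDC {x : Arr n n × Arr n n | IsStandardPair x.1 x.2} := by
  rintro ⟨a, b⟩ h ⟨a', b'⟩ h' e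
  have e' : ∀ i j, i ≤ j → j ≤ n → dint a n j + dint b i j = dint a' n j + dint b' i j := by
    intro i j hij hj
    have := congrFun (congrFun e i) j
    rwa [toDC_of_le _ hij hj, toDC_of_le _ hij hj] at this
  have hA : ∀ j ≤ n, dint a n j = dint a' n j := by
    intro j hj
    simpa [dint_zero_left] using e' 0 j (Nat.zero_le _) hj
  have hB : ∀ i j, i ≤ j → j ≤ n → dint b i j = dint b' i j := by
    intro i j hij hj
    linarith [e' i j hij hj, hA j hj]
  refine Prod.ext (dint_ext fun i hi j hj => ?_) (dint_ext fun i hi j hj => ?_)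
  · change dint a i j = dint a' i j
    rw [dint_eq_min h hi hj, dint_eq_min h' hi hj, hA _ (by omega)]
  · change dint b i j = dint b' i j
    rcases le_total i j with hij | hij
    · exact hB i j hij hj
    · rw [IsLTight.dint_eq h.2.1 h.2.2.2.1 hij, IsLTight.dint_eq h'.2.1 h'.2.2.2.1 hij,
        hB j j le_rfl hj]

/-- This bounds the mass of a diagonal box of `b`, which no rhombus inequality controls directly. By
the third kind of rhombus, the horizontal increment does not increase in the direction `(1, 1)`; on
the side of the grid it ends as the last part of `β`. -/
lemma DC_diag_step {α β γ : Fin n → ℝ} (hβ : IsPartition β) {V : Set ℝ} {f : ℕ → ℕ → ℝ}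
    (hf : f ∈ DC V α β γ) {p : ℕ} (hp : p < n) : f p (p + 1) ≤ f (p + 1) (p + 1) := by
  obtain ⟨-, -, ⟨-, -, h3⟩, -, hb, -, -⟩ := hf
  have key : ∀ d, p + 1 + d ≤ n →
      f (p + d + 1) (p + 1 + d) - f (p + d) (p + 1 + d) ≤ f (p + 1) (p + 1) - f p (p + 1) := by
    intro d
    induction d with
    | zero => intro _; simp
    | succ d ih =>
      intro hd
      have h1 := h3 (p + d) (p + 1 + d) (by omega) (by omega)
      have h2 := ih (by omega)
      rw [show p + (d + 1) + 1 = p + d + 2 by ring, show p + (d + 1) = p + d + 1 by ring,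
        show p + 1 + (d + 1) = p + 1 + d + 1 by ring]
      linarith
  have h1 := key (n - (p + 1)) (by omega)
  have h2 := hb ⟨n - 1, by omega⟩
  have h3 := hβ.2 ⟨n - 1, by omega⟩
  simp only at h2
  rw [show p + (n - (p + 1)) + 1 = n by omega, show p + (n - (p + 1)) = n - 1 by omega,
    show p + 1 + (n - (p + 1)) = n by omega] at h1
  rw [show n - 1 + 1 = n by omega] at h2
  linarith

lemma surjOn_toDC {α β γ : Fin n → ℝ} (hα : IsPartition α) (hβ : IsPartition β)
    (hγ : IsPartition γ) : Set.SurjOn toDC (SP (S : Set ℝ) α β γ) (DC (S : Set ℝ) α β γ) := by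
  intro f hf
  have hstep : ∀ p, p < n → f p (p + 1) ≤ f (p + 1) (p + 1) := fun p => DC_diag_step hβ hf
  obtain ⟨hoff, h00, ⟨r1, r2, r3⟩, hfα, hfβ, hfγ, hV⟩ := hf
  -- The data on the grid force the pair: `a` is diagonal with entries `α`, and the integral of `b`
  -- is continued below the diagonal by its diagonal values, which is what `min i j` does.
  set a := arrOf n n fun i j => f 0 (min i j) with ha_def
  set h : ℕ → ℕ → ℝ := fun i j => f (min i j) j - f 0 j with hh
  set b := arrOf n n h with hb_def
  have hda : ∀ i ≤ n, ∀ j ≤ n, dint a i j = f 0 (min i j) := fun i hi j hj =>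
    dint_arrOf (h := fun i j => f 0 (min i j)) (by simp [h00]) (by simp [h00]) hi hj
  have hdb : ∀ i ≤ n, ∀ j ≤ n, dint b i j = f (min i j) j - f 0 j := fun i hi j hj =>
    dint_arrOf (h := h) (by simp [hh]) (by simp [hh]) hi hj
  have hA : ∀ j ≤ n, dint a n j = f 0 j := fun j hj => by
    rw [hda n le_rfl j hj, min_eq_right hj]
  have ha : ∀ p q, 0 ≤ a p q := by
    intro p q
    simp only [ha_def, arrOf]
    rcases lt_trichotomy (p : ℕ) q with hpq | hpq | hpq
    · rw [min_eq_left (by omega), min_eq_left (by omega), min_eq_left (by omega),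
        min_eq_left (by omega)]
      linarith
    · rw [hpq]
      simp only [min_self, le_add_iff_nonneg_right, zero_le, inf_of_le_left, inf_of_le_right]
      linarith [hfα q, hα.2 q]
    · rw [min_eq_right (by omega), min_eq_right (by omega), min_eq_right (by omega),
        min_eq_right (by omega)]
      linarith
  have hb : ∀ p q, 0 ≤ b p q := by
    intro p q
    have hq := q.2
    simp only [hb_def, arrOf, hh]
    rcases lt_trichotomy (p : ℕ) q with hpq | hpq | hpq
    · rw [min_eq_left (by omega), min_eq_left (by omega), min_eq_left (by omega),
        min_eq_left (by omega)]
      linarith [r1 p q (by omega) (by omega)]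
    · rw [hpq]
      simp only [min_self, le_add_iff_nonneg_right, zero_le, inf_of_le_left, inf_of_le_right]
      linarith [hstep q hq]
    · rw [min_eq_right (by omega), min_eq_right (by omega), min_eq_right (by omega),
        min_eq_right (by omega)]
      linarith
  have hla : IsLTight a := by
    rw [isLTight_iff_of_lt ha]
    intro s k hs hk
    rw [hda _ (by omega) _ (by omega), hda _ (by omega) _ (by omega),
      hda _ (by omega) _ (by omega), hda _ (by omega) _ (by omega)]
    rcases lt_trichotomy s k with hsk | hsk | hsk
    · have h1 := hfα ⟨s, by omega⟩
      have h2 := hfα ⟨s + 1, by omega⟩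
      have h3 := hα.1 (show (⟨s, by omega⟩ : Fin n) ≤ ⟨s + 1, by omega⟩ by simp)
      simp only at h1 h2
      rw [min_eq_left (by omega), min_eq_left (by omega), min_eq_left (by omega),
        min_eq_left (by omega)]
      linarith
    · subst hsk
      simp
    · rw [min_eq_right (by omega), min_eq_right (by omega), min_eq_right (by omega),
        min_eq_right (by omega)]
  have hdta : IsDTight a := by
    rw [isDTight_iff_of_lt ha]
    intro i j hi hj
    rw [hda _ (by omega) _ (by omega), hda _ (by omega) _ (by omega),
      hda _ (by omega) _ (by omega), hda _ (by omega) _ (by omega)]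
    rcases lt_trichotomy i j with hij | hij | hij
    · rw [min_eq_left (by omega), min_eq_left (by omega), min_eq_left (by omega),
        min_eq_left (by omega)]
    · subst hij
      simp
    · have h1 := hfα ⟨j, by omega⟩
      have h2 := hfα ⟨j + 1, by omega⟩
      have h3 := hα.1 (show (⟨j, by omega⟩ : Fin n) ≤ ⟨j + 1, by omega⟩ by simp)
      simp only at h1 h2
      rw [min_eq_right (by omega), min_eq_right (by omega), min_eq_right (by omega),
        min_eq_right (by omega)]
      linarith
  have hlb : IsLTight b := by
    rw [isLTight_iff_of_lt hb]
    intro s k hs hk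
    rw [hdb _ (by omega) _ (by omega), hdb _ (by omega) _ (by omega),
      hdb _ (by omega) _ (by omega), hdb _ (by omega) _ (by omega)]
    rcases Nat.lt_or_ge s k with hsk | hsk
    · rw [min_eq_left (by omega), min_eq_left (by omega), min_eq_left (by omega),
        min_eq_left (by omega)]
      linarith [r3 s k (by omega) (by omega)]
    · rw [min_eq_right (by omega), min_eq_right (by omega), min_eq_right (by omega),
        min_eq_right (by omega)]
  have hfull : ∀ i ≤ n, ∀ j ≤ n, dint a n j + dint b i j = f (min i j) j := fun i hi j hj => by
    rw [hA j hj, hdb i hi j hj]; ring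
  have hd : IsDTight (concat a b) := by
    rw [isDTight_iff_of_lt (concat_nonneg ha hb)]
    intro i j hi hj
    rcases Nat.lt_or_ge i n with hin | hin
    · rw [dint_concat_left _ _ (by omega), dint_concat_left _ _ (by omega),
        dint_concat_left _ _ (by omega), dint_concat_left _ _ (by omega)]
      exact (isDTight_iff_of_lt ha).1 hdta i j hin hj
    · obtain ⟨d, rfl⟩ := Nat.exists_eq_add_of_le hin
      rw [add_assoc]
      simp only [dint_concat_right]
      rw [hfull _ (by omega) _ (by omega), hfull _ (by omega) _ (by omega),
        hfull _ (by omega) _ (by omega), hfull _ (by omega) _ (by omega)]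
      rcases Nat.lt_or_ge j d with hjd | hjd
      -- All four points lie outside the grid and are replaced by points on the hypotenuse, so the
      -- inequality is the monotonicity of `γ`.
      · have h1 := hfγ ⟨j, by omega⟩
        have h2 := hfγ ⟨j + 1, by omega⟩
        have h3 := hγ.1 (show (⟨j, by omega⟩ : Fin n) ≤ ⟨j + 1, by omega⟩ by simp)
        simp only at h1 h2
        rw [min_eq_right (by omega), min_eq_right (by omega), min_eq_right (by omega),
          min_eq_right (by omega)]
        linarith
      · rw [min_eq_left (by omega), min_eq_left (by omega), min_eq_left (by omega),
          min_eq_left (by omega)]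
        linarith [r2 d j hjd hj]
  refine ⟨(a, b), ?_, ?_⟩
  · rw [mem_SP_iff]
    refine ⟨⟨ha, hb, hla, hlb, hd⟩, fun k => ?_, fun k => ?_, fun k => ?_, fun p q => ?_,
      fun p q => ?_⟩
    · rw [hA _ (by omega), hA _ (by omega), hfα]
    · rw [hdb _ (by omega) _ le_rfl, hdb _ (by omega) _ le_rfl, min_eq_left (by omega),
        min_eq_left (by omega), ← hfβ]
      ring
    · rw [hfull _ le_rfl _ (by omega), hfull _ le_rfl _ (by omega), min_eq_right (by omega),
        min_eq_right (by omega), hfγ]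
    · exact S.add_mem (S.sub_mem (S.sub_mem (hV _ _) (hV _ _)) (hV _ _)) (hV _ _)
    · have : ∀ i j, h i j ∈ S := fun i j => S.sub_mem (hV _ _) (hV _ _)
      exact S.add_mem (S.sub_mem (S.sub_mem (this _ _) (this _ _)) (this _ _)) (this _ _)
  · funext i j
    rw [toDC_apply]
    split_ifs with hij
    · change dint a n j + dint b i j = f i j
      rw [hfull _ (by omega) _ hij.2, min_eq_left hij.1]
    · exact (hoff i j hij).symm

/-- Standard pairs correspond to discrete concave functions. -/
lemma bijOn_toDC {α β γ : Fin n → ℝ} (hα : IsPartition α) (hβ : IsPartition β)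
    (hγ : IsPartition γ) : Set.BijOn toDC (SP (S : Set ℝ) α β γ) (DC (S : Set ℝ) α β γ) :=
  ⟨mapsTo_toDC S α β γ, toDC_injOn.mono fun _ hx => hx.1, surjOn_toDC S hα hβ hγ⟩

end

/-! ### The array associativity map and its image. -/

section

variable {n m : ℕ}

/-! Condensations in both directions. -/

lemma sweep_commute {X : Type*} {D : ℕ → X → X} {g : X → X}
    (h : ∀ j, Function.Commute g (D j)) (k : ℕ) : Function.Commute g (sweep D k) := by
  induction k with
  | zero => exact fun _ => rfl
  | succ k ih => exact fun x => by rw [sweep, ih (D k x), (h k).eq]; rfl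

lemma commute_colT_rowT (s k e : ℕ) : Function.Commute (colT s) (sweep rowT k)^[e] :=
  (sweep_commute (fun j => colT_rowT_comm s j) k).iterate_right e

lemma boldD_boldL {a : Arr n m} (ha : ∀ i j, 0 ≤ a i j) : boldD (boldL a) = boldL (boldD a) := by
  apply dint_injective
  rw [dint_boldD (boldL_nonneg ha), dint_boldL ha, dint_boldL (boldD_nonneg ha), dint_boldD ha]
  exact ((sweep_commute (fun s => (commute_colT_rowT s (m - 1) m).symm) (n - 1)).iterate_right
    n).eq _

/-- Both condensations have the same shape. -/
lemma dint_boldL_top {a : Arr n m} (ha : ∀ i j, 0 ≤ a i j) {k : ℕ} (hn : k ≤ n) (hm : k ≤ m) :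
    dint (boldL a) k m = dint (boldD a) n k := by
  have h1 := boldL_nonneg ha
  have h2 := boldD_nonneg h1
  have hD := isDTight_boldD h1
  have hL := isLTight_boldD_of h1 (isLTight_boldL ha)
  -- Applying both condensations gives an integral that is the same at `(k, m)`, `(k, k)` and `(n,
  -- k)`. The first value is that of `boldL a`, the last that of `boldD a`, since the condensations
  -- commute.
  rw [← dint_boldD_top h1 k le_rfl, hD.dint_eq h2 hm, ← hL.dint_eq h2 hn, boldD_boldL ha,
    dint_boldL_right (boldD_nonneg ha) le_rfl]

lemma dint_boldD_mem (S : AddSubgroup ℝ) {a : Arr n m} (ha : ∀ i j, 0 ≤ a i j)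
    (h : ∀ i j, a i j ∈ S) : ∀ i j, boldD a i j ∈ S := by
  rw [← dint_mem_iff, dint_boldD ha]
  refine iterate_sweep_induction (fun f : ℕ → ℕ → ℝ => ∀ i j, f i j ∈ S) m
    (fun r _ f hf i k => ?_) ((dint_mem_iff S).2 h)
  by_cases hk : k = r + 1
  · rw [hk, rowT_line]
    exact upd_mem S (fun i => hf _ _) (fun i => hf _ _) (fun i => hf _ _) i
  · rw [rowT_of_ne _ _ hk]
    exact hf i k

lemma concat_mem (S : AddSubgroup ℝ) {n' : ℕ} {a : Arr n m} {b : Arr n' m}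
    (ha : ∀ i j, a i j ∈ S) (hb : ∀ i j, b i j ∈ S) : ∀ i j, concat a b i j ∈ S := by
  intro i j
  refine Fin.addCases (fun i => ?_) (fun i => ?_) i
  · rw [concat, Fin.append_left]; exact ha i j
  · rw [concat, Fin.append_right]; exact hb i j

lemma concat_halves (P : Arr (n + n) m) : concat (firstHalf P) (secondHalf P) = P :=
  Fin.append_castAdd_natAdd

lemma dint_firstHalf (P : Arr (n + n) m) {i : ℕ} (hi : i ≤ n) (j : ℕ) :
    dint (firstHalf P) i j = dint P i j := by
  conv_rhs => rw [← concat_halves P]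
  rw [dint_concat_left _ _ hi]

lemma dint_secondHalf (P : Arr (n + n) m) (i j : ℕ) :
    dint (secondHalf P) i j = dint P (n + i) j - dint P n j := by
  have := dint_concat_right (firstHalf P) (secondHalf P) i j
  rw [concat_halves, dint_firstHalf P le_rfl] at this
  linarith

lemma dint_zero_arr (i j : ℕ) : dint (0 : Arr n m) i j = 0 := by simp [dint]

lemma dint_concat_zero {n' : ℕ} (a : Arr n m) (i j : ℕ) :
    dint (concat a (0 : Arr n' m)) i j = dint a i j := by
  rcases le_total i n with h | h
  · exact dint_concat_left _ _ h _
  · obtain ⟨d, rfl⟩ := Nat.exists_eq_add_of_le h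
    rw [dint_concat_right, dint_zero_arr, add_zero, dint_of_le_left a h]

/-- An `𝐋`-tight array with `n` rows has no mass outside of the first `n` columns. -/
lemma IsLTight.eq_concat_zero {P : Arr (n + n) n} (hP : ∀ i j, 0 ≤ P i j) (h : IsLTight P) :
    P = concat (firstHalf P) (0 : Arr n n) := by
  refine dint_ext fun i _ j hj => ?_
  rw [dint_concat_zero]
  rcases le_total i n with hi | hi
  · rw [dint_firstHalf _ hi]
  · rw [dint_of_le_left _ hi, dint_firstHalf _ le_rfl, h.dint_eq hP (hj.trans hi),
      h.dint_eq hP hj]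

lemma eq_of_increments {u v : ℕ → ℝ} (h0 : u 0 = v 0)
    (h : ∀ k : Fin n, u (k + 1) - u k = v (k + 1) - v k) {k : ℕ} (hk : k ≤ n) : u k = v k := by
  induction k with
  | zero => exact h0
  | succ k ih =>
    have := h ⟨k, hk⟩
    have h2 := ih (by omega)
    simp only at this
    linarith

lemma isPartition_of_convex {t : ℕ → ℝ} {τ : Fin n → ℝ} (h : ∀ k : Fin n, t (k + 1) - t k = τ k)
    (h1 : ∀ k, t k ≤ t (k + 1)) (h2 : ∀ k, t (k + 2) + t k ≤ 2 * t (k + 1)) : IsPartition τ := by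
  have hanti : Antitone fun k => t (k + 1) - t k :=
    antitone_nat_of_succ_le fun k => by linarith [h2 k]
  refine ⟨fun i j hij => ?_, fun i => ?_⟩
  · rw [← h, ← h]
    exact hanti (show (i : ℕ) ≤ j from hij)
  · rw [← h]
    linarith [h1 i]

/-- Two standard pairs `(a, b)` and `(l, c)`, where `l` has the shape of `a ⊗ b`. -/
structure IsLeftCouple (a b l c : Arr n n) : Prop where
  fst : IsStandardPair a b
  snd : IsStandardPair l c
  glue : ∀ k, dint l n k = dint a n k + dint b n k

lemma isLeftCouple_of_mem (S : AddSubgroup ℝ) {lam mu nu ro σ : Fin n → ℝ} {a b l c : Arr n n}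
    (h1 : (a, b) ∈ SP (S : Set ℝ) lam mu σ) (h2 : (l, c) ∈ SP (S : Set ℝ) σ nu ro) :
    IsLeftCouple a b l c := by
  rw [mem_SP_iff] at h1 h2
  have key : ∀ k ≤ n, dint l n k = dint a n k + dint b n k := fun k hk =>
    eq_of_increments (u := fun k => dint l n k) (v := fun k => dint a n k + dint b n k)
      (by simp [dint_zero_right]) (fun k => by rw [h2.2.1, h1.2.2.2.1]) hk
  refine ⟨h1.1, h2.1, fun k => ?_⟩
  rcases le_total k n with hk | hk
  · exact key k hk
  · rw [dint_of_le_right _ hk, dint_of_le_right _ hk, dint_of_le_right _ hk, key n le_rfl]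

namespace IsLeftCouple

variable {a b l c : Arr n n}

/-- Condensing the tight array `a ⊗ b` to the left keeps it tight downwards, so the result is
diagonal. Its row sums are those of `a ⊗ b`, which are the row sums of the diagonal array `l`. -/
lemma boldL_eq (h : IsLeftCouple a b l c) : boldL (concat a b) = concat l (0 : Arr n n) := by
  have hn := concat_nonneg h.fst.1 h.fst.2.1
  have hP := boldL_nonneg hn
  have hL := isLTight_boldL hn
  have hD := isDTight_boldL_of hn h.fst.2.2.2.2
  have key : ∀ k ≤ n, dint (boldL (concat a b)) k k = dint l n k := by
    intro k hk
    rw [← hL.dint_eq hP (i := n + n) (by omega), dint_boldL_right hn le_rfl, dint_concat_right,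
      h.glue]
  have hmin : ∀ i j, j ≤ n → dint (boldL (concat a b)) i j = dint l n (min i j) := by
    intro i j hj
    rcases le_total i j with hij | hij
    · rw [hD.dint_eq hP hij, key _ (by omega), min_eq_left hij]
    · rw [hL.dint_eq hP hij, key _ hj, min_eq_right hij]
  refine dint_ext fun i _ j hj => ?_
  rw [dint_concat_zero, hmin i j hj]
  rcases le_total i n with hi | hi
  · rw [dint_eq_min h.snd hi hj]
  · rw [dint_of_le_left _ hi, min_eq_right (by omega)]

lemma nonneg (h : IsLeftCouple a b l c) : ∀ i j, 0 ≤ concat b c i j :=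
  concat_nonneg h.fst.2.1 h.snd.2.1

lemma boldL_eq' (h : IsLeftCouple a b l c) :
    boldL (concat b c) = concat (firstHalf (boldL (concat b c))) (0 : Arr n n) :=
  (isLTight_boldL h.nonneg).eq_concat_zero (boldL_nonneg h.nonneg)

lemma dint_firstHalf_boldL (h : IsLeftCouple a b l c) (i j : ℕ) :
    dint (firstHalf (boldL (concat b c))) i j = dint (boldL (concat b c)) i j := by
  conv_rhs => rw [h.boldL_eq']
  rw [dint_concat_zero]

/-- `b ⊗ c` need not be tight to the left, but row operations preserve the inequalities for each
pair of adjacent columns separately, hence the tightness of each half. -/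
lemma isLTight_fst (h : IsLeftCouple a b l c) : IsLTight (firstHalf (boldD (concat b c))) := by
  rw [isLTight_iff_of_lt (a := firstHalf (boldD (concat b c)))
    fun i j => boldD_nonneg h.nonneg _ _]
  intro s k hs _
  simp only [dint_firstHalf _ hs, dint_firstHalf _ (show s + 1 ≤ n by omega),
    dint_firstHalf _ (show s ≤ n by omega)]
  have hb := (isLTight_iff h.fst.2.1).1 h.fst.2.2.2.1 s
  rw [colT_eq_self_iff] at hb
  have := dint_boldD_slack h.nonneg (s := s) (κ := 0) (fun k => by
    simp only [dint_concat_left b c hs, dint_concat_left b c (show s + 1 ≤ n by omega),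
      dint_concat_left b c (show s ≤ n by omega)]
    linarith [hb k]) k
  linarith

lemma isLTight_snd (h : IsLeftCouple a b l c) : IsLTight (secondHalf (boldD (concat b c))) := by
  rw [isLTight_iff_of_lt (a := secondHalf (boldD (concat b c)))
    fun i j => boldD_nonneg h.nonneg _ _]
  intro s k _ _
  simp only [dint_secondHalf]
  have hc := (isLTight_iff h.snd.2.1).1 h.snd.2.2.2.1 s
  rw [colT_eq_self_iff] at hc
  have := dint_boldD_slack h.nonneg (s := n + s) (κ := 0) (fun k => by
    simp only [add_assoc, dint_concat_right]
    linarith [hc k]) k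
  simp only [← add_assoc]
  linarith

lemma standard_fst (h : IsLeftCouple a b l c) :
    IsStandardPair (firstHalf (boldD (concat b c))) (secondHalf (boldD (concat b c))) :=
  ⟨fun _ _ => boldD_nonneg h.nonneg _ _, fun _ _ => boldD_nonneg h.nonneg _ _, h.isLTight_fst,
    h.isLTight_snd, by rw [concat_halves]; exact isDTight_boldD h.nonneg⟩

/-- The tightness of `a ⊗ b` bounds the columns of `b`, and that of `l ⊗ c` bounds the columns of
`c`, because `l` has the row sums of `a ⊗ b`. So `b ⊗ c` satisfies the row inequalities with the
constant coming from `a`, and column operations preserve these. -/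
lemma standard_snd (h : IsLeftCouple a b l c) :
    IsStandardPair a (firstHalf (boldL (concat b c))) := by
  have hn : ∀ i j, 0 ≤ firstHalf (boldL (concat b c)) i j := fun _ _ => boldL_nonneg h.nonneg _ _
  have hL := isLTight_boldL h.nonneg
  refine ⟨h.fst.1, hn, h.fst.2.2.1, ?_, ?_⟩
  · rw [isLTight_iff hn]
    rw [isLTight_iff (boldL_nonneg h.nonneg)] at hL
    simp only [colT_eq_self_iff, h.dint_firstHalf_boldL] at hL ⊢
    exact hL
  · rw [isDTight_concat_iff h.fst.1 hn]
    have hab := (isDTight_concat_iff h.fst.1 h.fst.2.1).1 h.fst.2.2.2.2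
    have hlc := ((isDTight_concat_iff h.snd.1 h.snd.2.1).1 h.snd.2.2.2.2).2
    refine ⟨hab.1, fun j i => ?_⟩
    simp only [h.dint_firstHalf_boldL]
    refine dint_boldL_slack h.nonneg (fun i => ?_) i
    rcases Nat.lt_or_ge i n with hi | hi
    · rw [dint_concat_left _ _ (by omega), dint_concat_left _ _ (by omega),
        dint_concat_left _ _ (by omega), dint_concat_left _ _ (by omega)]
      exact hab.2 j i
    · obtain ⟨d, rfl⟩ := Nat.exists_eq_add_of_le hi
      rw [add_assoc]
      simp only [dint_concat_right]
      have := hlc j d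
      simp only [h.glue] at this
      linarith

lemma dint_boldL_col (h : IsLeftCouple a b l c) {k : ℕ} (hk : k ≤ n) :
    dint (boldL (concat b c)) k n = dint (boldD (concat b c)) (n + n) k :=
  dint_boldL_top h.nonneg (by omega) hk

/-- The first half of the condensed array is diagonal, so its row sums are its column sums, and
these are the column sums of `b`. -/
lemma dint_fst (h : IsLeftCouple a b l c) {k : ℕ} (hk : k ≤ n) :
    dint (firstHalf (boldD (concat b c))) n k = dint b k n := by
  have h1 := dint_eq_min h.standard_fst le_rfl hk
  have h2 := dint_eq_min h.standard_fst hk le_rfl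
  rw [min_eq_right hk] at h1
  rw [min_eq_left hk] at h2
  rw [← h2, dint_firstHalf _ hk, dint_boldD_top h.nonneg _ le_rfl, dint_concat_left _ _ hk]

end IsLeftCouple

lemma mapsTo_arrayAssoc (S : AddSubgroup ℝ) (lam mu nu ro : Fin n → ℝ) :
    Set.MapsTo arrayAssoc (leftCouples (SP (S : Set ℝ)) lam mu nu ro)
      (rightCouples (SP (S : Set ℝ)) lam mu nu ro) := by
  rintro ⟨⟨a, b⟩, ⟨l, c⟩⟩ ⟨σ, hσ, h1, h2⟩
  have h := isLeftCouple_of_mem S h1 h2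
  simp only [mem_SP_iff] at h1 h2
  have hn := h.nonneg
  have hmem := concat_mem S h1.2.2.2.2.2 h2.2.2.2.2.2
  have hDmem := dint_boldD_mem S hn hmem
  have hLmem : ∀ i j, boldL (concat b c) i j ∈ S := fun i j =>
    dint_boldD_mem S (a := transp (concat b c)) (fun i j => hn j i) (fun i j => hmem j i) j i
  have hf := isIntegral_dint.2 (boldL_nonneg hn)
  have hL := (isLTight_iff (boldL_nonneg hn)).1 (isLTight_boldL hn)
  simp only [colT_eq_self_iff] at hL
  -- The shape `τ` is taken as the column sums of `𝐋(b ⊗ c)`, which are also the row sums of `𝐃(b ⊗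
  -- c)`.
  refine ⟨fun k => dint (boldL (concat b c)) (k + 1) n - dint (boldL (concat b c)) k n,
    isPartition_of_convex (t := fun k => dint (boldL (concat b c)) k n) (fun _ => rfl)
      (fun k => hf.mono_left k n) (fun k => ?_), ?_, ?_⟩
  · have := hL k n
    simp only [dint_of_le_right _ (show n ≤ n + 1 by omega)] at this
    linarith
  · simp only [arrayAssoc]
    rw [mem_SP_iff]
    refine ⟨h.standard_fst, fun k => ?_, fun k => ?_, fun k => ?_, fun _ _ => hDmem _ _,
      fun _ _ => hDmem _ _⟩
    · rw [h.dint_fst (by omega), h.dint_fst (by omega), h1.2.2.1]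
    · simp only [dint_secondHalf, dint_boldD_top hn _ le_rfl, dint_concat_right]
      rw [← h2.2.2.1]
      ring
    · simp only [dint_secondHalf, dint_firstHalf _ le_rfl]
      rw [h.dint_boldL_col (by omega), h.dint_boldL_col (by omega)]
      ring
  · simp only [arrayAssoc]
    rw [mem_SP_iff]
    refine ⟨h.standard_snd, h1.2.1, fun k => ?_, fun k => ?_, h1.2.2.2.2.1, fun _ _ => hLmem _ _⟩
    · simp only [h.dint_firstHalf_boldL]
    · rw [← h2.2.2.2.1, dint_firstHalf _ le_rfl, dint_firstHalf _ le_rfl, h.glue, h.glue]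
      have hz : ∀ k ≤ n, dint (boldL (concat b c)) n k = dint b n k + dint c n k := by
        intro k hk
        rw [(isLTight_boldL hn).dint_eq (boldL_nonneg hn) hk,
          ← (isLTight_boldL hn).dint_eq (boldL_nonneg hn) (i := n + n) (by omega),
          dint_boldL_right hn le_rfl, dint_concat_right]
      rw [hz _ (by omega), hz _ (by omega)]
      ring

end

/-! ### The octahedron recurrence as insertion of columns. -/

section

variable {n : ℕ}

/-! The octahedron recurrence. -/

/-- The octahedron recurrence in the tetrahedron `0 ≤ x ≤ y ≤ z ≤ n`. -/
def IsOctahedral (n : ℕ) (F : ℕ → ℕ → ℕ → ℝ) : Prop :=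
  ∀ x y z, x < y → y ≤ z → z < n → F (x + 1) y (z + 1) + F x y z =
    max (F x y (z + 1) + F (x + 1) y z) (F (x + 1) (y + 1) (z + 1) + F x (y - 1) z)

lemma isOctahedral_tetra (n : ℕ) (f g : ℕ → ℕ → ℝ) : IsOctahedral n (tetra f g) := by
  intro x y z hxy hyz _
  obtain ⟨d, rfl⟩ := Nat.exists_eq_add_of_le hyz
  simp only [tetra]
  rw [show y + d + 1 - y = d + 1 by omega, show y + d - y = d by omega,
    show y + d + 1 - (y + 1) = d by omega, show y + d - (y - 1) = d + 1 by omega, propagate]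
  ring

lemma tetra_zero (f g : ℕ → ℕ → ℝ) {y z : ℕ} (h : y ≤ z) : tetra f g 0 y z = f y z := by
  rw [tetra, propagate, Nat.add_sub_cancel' h]

lemma tetra_self (f g : ℕ → ℕ → ℝ) (x y : ℕ) : tetra f g (x + 1) y y = g (x + 1) y := by
  rw [tetra, Nat.sub_self, propagate]

lemma IsOctahedral.eq_of_faces {F G : ℕ → ℕ → ℕ → ℝ} (hF : IsOctahedral n F)
    (hG : IsOctahedral n G) (h0 : ∀ y z, y ≤ z → z ≤ n → F 0 y z = G 0 y z)
    (h1 : ∀ x y, x < y → y ≤ n → F (x + 1) y y = G (x + 1) y y) {x y z : ℕ} (hxy : x ≤ y)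
    (hyz : y ≤ z) (hz : z ≤ n) : F x y z = G x y z := by
  induction x generalizing y z with
  | zero => exact h0 y z hyz hz
  | succ x ihx =>
    obtain ⟨d, rfl⟩ := Nat.exists_eq_add_of_le hyz
    induction d generalizing y with
    | zero => exact h1 x y hxy hz
    | succ d ihd =>
      have e1 := hF x y (y + d) hxy (by omega) (by omega)
      have e2 := hG x y (y + d) hxy (by omega) (by omega)
      have a1 := ihx (y := y) (z := y + d) (by omega) (by omega) (by omega)
      have a2 := ihx (y := y) (z := y + d + 1) (by omega) (by omega) (by omega)
      have a3 := ihx (y := y - 1) (z := y + d) (by omega) (by omega) (by omega)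
      have a4 := ihd (y := y) hxy (by omega) (by omega)
      have a5 := ihd (y := y + 1) (by omega) (by omega) (by omega)
      rw [show y + 1 + d = y + d + 1 by ring] at a5
      rw [a1, a2, a3, a4, a5, ← e2] at e1
      rw [← add_assoc]
      linarith

/-! Insertion of columns, one after the other. -/

lemma sweep_colT_of_lt {k i : ℕ} (f : ℕ → ℕ → ℝ) (h : k < i) : sweep colT k f i = f i :=
  sweep_induction (fun g : ℕ → ℕ → ℝ => g i = f i)
    (fun s hs g hg => by rw [colT_of_ne _ (by omega)]; exact hg) rfl

/-- The factor with the largest index acts first: when a line is updated, its right neighbour is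
already new and its left neighbour still old. -/
lemma sweep_colT_line {k y : ℕ} (f : ℕ → ℕ → ℝ) (h : y < k) :
    sweep colT k f (y + 1) = upd (f y) (f (y + 1)) (sweep colT k f (y + 2)) := by
  induction k generalizing f with
  | zero => omega
  | succ k ih =>
    rw [sweep]
    rcases Nat.lt_succ_iff_lt_or_eq.1 h with h' | rfl
    · rw [ih _ h', colT_of_ne (i := y) _ (by omega), colT_of_ne (i := y + 1) _ (by omega)]
    · rw [sweep_colT_of_lt _ (by omega), sweep_colT_of_lt _ (by omega), colT_line,
        colT_of_ne (i := y + 2) _ (by omega)]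

/-- The integral after the columns with the numbers `n, …, n + x - 1` have been inserted into the
first `n` columns. -/
def insertCols (n : ℕ) (f : ℕ → ℕ → ℝ) : ℕ → ℕ → ℕ → ℝ
  | 0 => f
  | x + 1 => sweep colT (n + x) (insertCols n f x)

lemma insertCols_of_le (f : ℕ → ℕ → ℝ) {x i : ℕ} (h : n + x ≤ i) : insertCols n f x i = f i := by
  induction x with
  | zero => rfl
  | succ x ih => rw [insertCols, sweep_colT_of_lt _ (by omega), ih (by omega)]

/-- Each insertion adds one column to the tight initial part: `sweep_shift` moves the known
tightness one place to the right, and `sweep_zero` supplies the first place. -/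
lemma colT_insertCols {f : ℕ → ℕ → ℝ} (h : ∀ s, s + 2 ≤ n → colT s f = f) {x s : ℕ}
    (hs : s + 2 ≤ n + x) : colT s (insertCols n f x) = insertCols n f x := by
  induction x generalizing s with
  | zero => exact h s hs
  | succ x ih =>
    rw [insertCols]
    cases s with
    | zero => exact isHecke_colT.sweep_zero (by omega) _
    | succ s => rw [isHecke_colT.sweep_shift (by omega), ih (by omega)]

lemma isIntegral_insertCols {f : ℕ → ℕ → ℝ} (h : IsIntegral f) (x : ℕ) :
    IsIntegral (insertCols n f x) := by
  induction x with
  | zero => exact h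
  | succ x ih => exact sweep_induction IsIntegral (fun s _ g hg => hg.map_colT s) ih

lemma insertCols_commute {W : (ℕ → ℕ → ℝ) → ℕ → ℕ → ℝ}
    (hW : ∀ s, Function.Commute W (colT s)) (f : ℕ → ℕ → ℝ) (x : ℕ) :
    W (insertCols n f x) = insertCols n (W f) x := by
  induction x with
  | zero => rfl
  | succ x ih => rw [insertCols, insertCols, ← ih]; exact sweep_commute hW _ _

namespace IsLeftCouple

variable {a b l c : Arr n n}

lemma colT_eq (h : IsLeftCouple a b l c) (s : ℕ) (hs : s + 2 ≤ n) :
    colT s (dint (concat b c)) = dint (concat b c) := by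
  have hb := (isLTight_iff h.fst.2.1).1 h.fst.2.2.2.1 s
  rw [colT_eq_self_iff] at hb ⊢
  simp only [dint_concat_left b c hs, dint_concat_left b c (show s + 1 ≤ n by omega),
    dint_concat_left b c (show s ≤ n by omega)]
  exact hb

/-- The column sums after the insertion of `x` columns. -/
lemma insertCols_top (h : IsLeftCouple a b l c) (x : ℕ) {y : ℕ} (hy : y ≤ n) :
    insertCols n (dint (concat b c)) x y n = dint (boldD (concat b c)) (n + x) y := by
  set G := insertCols n (dint (concat b c)) x with hG
  set W := (sweep rowT (n - 1))^[n] with hW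
  have hcomm : ∀ s, Function.Commute W (colT s) := fun s => (commute_colT_rowT s (n - 1) n).symm
  have hint : IsIntegral (W G) :=
    iterate_sweep_induction IsIntegral n (fun j _ f hf => hf.map_rowT j)
      (isIntegral_insertCols (isIntegral_dint.2 h.nonneg) x)
  have htop : W G y n = G y n :=
    iterate_sweep_induction (fun f : ℕ → ℕ → ℝ => f y n = G y n) n
      (fun j hj f hf => by rw [rowT_of_ne _ _ (by omega)]; exact hf) rfl
  -- After the row condensation `W` the first `n + x` columns are tight in both directions, so the
  -- values at `(y, n)`, `(y, y)` and `(n + x, y)` agree.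
  have hrow : W G y n = W G y y := by
    refine hint.swap.eq_diag (M := n) (fun s hs => ?_) hy le_rfl
    have := isHecke_rowT.iterate_tight (j := s) (k := n - 1) (e := n) (by omega) (by omega) G
    funext k i
    exact congrFun (congrFun this i) k
  have hcol : W G (n + x) y = W G y y := by
    refine hint.eq_diag (M := n + x) (fun s hs => ?_) (by omega) le_rfl
    rw [← (hcomm s).eq, colT_insertCols h.colT_eq hs]
  -- `W` commutes with the insertion, and the insertion of `x` columns leaves the line `n + x`
  -- alone; so the value on this line is that of `W` applied to the original integral.
  rw [← htop, hrow, ← hcol, insertCols_commute hcomm, insertCols_of_le _ le_rfl,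
    dint_boldD h.nonneg]

/-- The change of a line under an insertion is monotone in `z` and vanishes at `z = 0`. It also
vanishes at `z = n`: there it is an increment of the integral of `𝐃(b ⊗ c)` in a box column to the
right of the diagonal of the second half, which is tight to the left. -/
lemma insertCols_succ_eq (h : IsLeftCouple a b l c) {x y z : ℕ} (hx : x < n) (hy : y ≤ x)
    (hz : z ≤ n) : insertCols n (dint (concat b c)) (x + 1) y z =
      insertCols n (dint (concat b c)) x y z := by
  set f := dint (concat b c) with hf
  have hI : IsIntegral f := isIntegral_dint.2 h.nonneg
  cases y with
  | zero => rw [(isIntegral_insertCols hI _).left, (isIntegral_insertCols hI _).left]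
  | succ y =>
    have hline : insertCols n f (x + 1) (y + 1) = upd (insertCols n f x y)
        (insertCols n f x (y + 1)) (insertCols n f (x + 1) (y + 2)) :=
      sweep_colT_line _ (by omega)
    have hmono : Monotone fun z =>
        insertCols n f (x + 1) (y + 1) z - insertCols n f x (y + 1) z := by
      refine monotone_nat_of_le_succ fun z => ?_
      rw [hline]
      linarith [upd_step (insertCols n f x y) (insertCols n f x (y + 1))
        (insertCols n f (x + 1) (y + 2)) z]
    have h1 := hmono hz
    have h2 := hmono (Nat.zero_le z)
    have h3 : insertCols n f (x + 1) (y + 1) n = insertCols n f x (y + 1) n := by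
      rw [hf, h.insertCols_top _ (by omega), h.insertCols_top _ (by omega)]
      have e1 := dint_secondHalf (boldD (concat b c)) (x + 1) (y + 1)
      have e2 := dint_secondHalf (boldD (concat b c)) x (y + 1)
      rw [h.isLTight_snd.dint_eq h.standard_fst.2.1 (by omega)] at e1 e2
      linarith
    simp only [(isIntegral_insertCols hI _).bot, h3] at h1 h2
    linarith

/-- After the insertion of all columns, the condensation to the left is obtained. -/
lemma insertCols_last (h : IsLeftCouple a b l c) :
    insertCols n (dint (concat b c)) n = dint (boldL (concat b c)) := by
  rw [dint_boldL h.nonneg]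
  set f := dint (concat b c) with hf
  set G := insertCols n f n with hG
  have hfix : (sweep colT (n + n - 1))^[n + n] G = G := by
    refine Function.iterate_fixed ?_ _
    exact sweep_induction (fun g => g = G)
      (fun s hs g hg => by rw [hg]; exact colT_insertCols h.colT_eq (by omega)) rfl
  -- The full condensation absorbs every column operation, so it has the same value before and after
  -- the insertions; on the result `G` it does nothing.
  have habs : ∀ x ≤ n, (sweep colT (n + n - 1))^[n + n] (insertCols n f x) =
      (sweep colT (n + n - 1))^[n + n] f := by
    intro x
    induction x with
    | zero => intro _; rfl
    | succ x ih =>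
      intro hx
      refine sweep_induction (fun g => (sweep colT (n + n - 1))^[n + n] g =
        (sweep colT (n + n - 1))^[n + n] f) (fun s hs g hg => ?_) (ih (by omega))
      rw [isHecke_colT.iterate_absorb (by omega) (by omega), hg]
  rw [← hfix, hG, habs n le_rfl]

lemma insertCols_diag (h : IsLeftCouple a b l c) {i j : ℕ} (hi : i ≤ n) (hj : j ≤ n) :
    insertCols n (dint (concat b c)) i i j = dint (boldL (concat b c)) i j := by
  rw [← h.insertCols_last]
  have key : ∀ d, i + d ≤ n → insertCols n (dint (concat b c)) (i + d) i j =
      insertCols n (dint (concat b c)) i i j := by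
    intro d
    induction d with
    | zero => intro _; rfl
    | succ d ih =>
      intro hd
      rw [← add_assoc, h.insertCols_succ_eq (by omega) (by omega) hj, ih (by omega)]
  rw [← key (n - i) (by omega), Nat.add_sub_cancel' hi]

/-- The function on the tetrahedron which the octahedron recurrence produces. -/
lemma tetra_eq (h : IsLeftCouple a b l c) {x y z : ℕ} (hxy : x ≤ y) (hyz : y ≤ z) (hz : z ≤ n) :
    tetra (toDC (a, b)) (toDC (l, c)) x y z =
      dint a n z + insertCols n (dint (concat b c)) x y z := by
  refine (isOctahedral_tetra n _ _).eq_of_faces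
    (G := fun x y z => dint a n z + insertCols n (dint (concat b c)) x y z)
    (fun x y z hxy hyz hz => ?_) (fun y z hyz hz => ?_) (fun x y hxy hy => ?_) hxy hyz hz
  · obtain ⟨y, rfl⟩ : ∃ y', y = y' + 1 := ⟨y - 1, by omega⟩
    have hline : insertCols n (dint (concat b c)) (x + 1) (y + 1) =
        upd (insertCols n (dint (concat b c)) x y) (insertCols n (dint (concat b c)) x (y + 1))
          (insertCols n (dint (concat b c)) (x + 1) (y + 2)) :=
      sweep_colT_line _ (by omega)
    have := congrFun hline (z + 1)
    rw [upd_succ, ← hline] at this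
    simp only [add_tsub_cancel_right]
    rw [this]
    -- Every product in the recurrence has one factor at height `z + 1` and one at height `z`, so
    -- adding the row sums of `a` changes all terms equally.
    rw [show ∀ A B p q : ℝ, A + (p - q) + (B + q) = A + B + p by intros; ring,
      ← max_add_add_left]
    congr 1 <;> ring
  · rw [tetra_zero _ _ hyz, toDC_of_le _ hyz hz, insertCols, dint_concat_left _ _ (by omega)]
  · rw [tetra_self, toDC_of_le _ (by omega) hy]
    -- On the face `y = z` the value is the total of the first `n + (x + 1)` columns up to row `y`:
    -- these columns are tight, and insertion leaves the last of these lines unchanged.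
    have hI := isIntegral_insertCols (n := n) (isIntegral_dint.2 h.nonneg) (x + 1)
    have := hI.eq_diag (M := n + (x + 1)) (fun s hs => colT_insertCols h.colT_eq hs)
      (i := n + (x + 1)) (j := y) (by omega) le_rfl
    simp only
    rw [← this, insertCols_of_le _ le_rfl, dint_concat_right, h.glue]
    ring

/-- The functional and the array associativity maps coincide. -/
lemma funAssoc_eq (h : IsLeftCouple a b l c) :
    funAssoc n (toDC (a, b), toDC (l, c)) =
      (toDC (arrayAssoc ((a, b), (l, c))).1, toDC (arrayAssoc ((a, b), (l, c))).2) := by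
  have hI := isIntegral_dint.2 h.nonneg
  refine Prod.ext ?_ ?_ <;> funext i j <;> simp only [funAssoc, onGrid, toDC_apply, arrayAssoc] <;>
    split_ifs with hij
  · rw [h.tetra_eq hij.1 hij.2 le_rfl, h.tetra_eq le_rfl (Nat.zero_le _) le_rfl,
      h.insertCols_top _ hij.2, (isIntegral_insertCols hI _).left, dint_secondHalf,
      dint_firstHalf _ le_rfl]
    ring
  · rfl
  · rw [h.tetra_eq le_rfl hij.1 hij.2, h.insertCols_diag (by omega) hij.2,
      h.dint_firstHalf_boldL]
  · rfl

end IsLeftCouple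

end

/-! ### Bijectivity by reflection of the tetrahedron. -/

section

variable {n : ℕ}

/-! The symmetry of the tetrahedron which exchanges the initial and the final faces. -/

/-- The reflection permutes the opposite pairs of vertices of an octahedron within the same roles.
All three pairs have the same coordinate sum, so a multiple of `x + y + z` may be added; this is
used to keep the reflected increments nonnegative. -/
lemma IsOctahedral.reflect {F : ℕ → ℕ → ℕ → ℝ} (hF : IsOctahedral n F) (K C : ℝ) :
    IsOctahedral n fun x y z => F (n - z) (n - y) (n - x) + K * (x + y + z) + C := by
  intro x y z hxy hyz hz
  have := hF (n - (z + 1)) (n - y) (n - (x + 1)) (by omega) (by omega) (by omega)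
  rw [show n - (z + 1) + 1 = n - z by omega, show n - (x + 1) + 1 = n - x by omega,
    show n - y + 1 = n - (y - 1) by omega, show n - y - 1 = n - (y + 1) by omega] at this
  have hy : ((y - 1 : ℕ) : ℝ) = y - 1 := by rw [Nat.cast_sub (by omega)]; simp
  simp only [hy]
  push_cast
  set A := F (n - (z + 1)) (n - y) (n - x)
  set B := F (n - z) (n - y) (n - (x + 1))
  set D := F (n - (z + 1)) (n - (y + 1)) (n - (x + 1))
  set E := F (n - z) (n - (y - 1)) (n - x)
  have e1 : max (A + K * (x + y + (z + 1)) + C + (B + K * (x + 1 + y + z) + C))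
      (D + K * (x + 1 + (y + 1) + (z + 1)) + C + (E + K * (x + (y - 1) + z) + C)) =
      max (A + B) (E + D) + (K * (2 * x + 2 * y + 2 * z + 2) + 2 * C) := by
    rw [← max_add_add_right]; congr 1 <;> ring
  rw [e1]
  linarith

lemma IsOctahedral.eq_of_final_faces {F G : ℕ → ℕ → ℕ → ℝ} (hF : IsOctahedral n F)
    (hG : IsOctahedral n G) (h0 : ∀ x y, x ≤ y → y ≤ n → F x y n = G x y n)
    (h1 : ∀ x z, x ≤ z → z ≤ n → F x x z = G x x z) {x y z : ℕ} (hxy : x ≤ y)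
    (hyz : y ≤ z) (hz : z ≤ n) : F x y z = G x y z := by
  have := (hF.reflect 0 0).eq_of_faces (hG.reflect 0 0)
    (fun y z hyz hz => by simp [h0 (n - z) (n - y) (by omega) (by omega)])
    (fun x y hxy hy => by simp [h1 (n - y) (n - (x + 1)) (by omega) (by omega)])
    (x := n - z) (y := n - y) (z := n - x) (by omega) (by omega) (by omega)
  simpa [show n - (n - x) = x by omega, show n - (n - y) = y by omega,
    show n - (n - z) = z by omega] using this

lemma tetra_self' {f g : ℕ → ℕ → ℝ} (h : ∀ y ≤ n, g 0 y = f y y) (x : ℕ) {y : ℕ} (hy : y ≤ n) :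
    tetra f g x y y = g x y := by
  cases x with
  | zero => rw [tetra_zero _ _ le_rfl, h y hy]
  | succ x => exact tetra_self f g x y

lemma DC_glue {V : Set ℝ} {α β γ α' β' : Fin n → ℝ} {f g : ℕ → ℕ → ℝ} (hf : f ∈ DC V α β γ)
    (hg : g ∈ DC V γ α' β') {y : ℕ} (hy : y ≤ n) : g 0 y = f y y :=
  eq_of_increments (u := fun y => g 0 y) (v := fun y => f y y) (by rw [hf.2.1, hg.2.1])
    (fun k => by rw [hg.2.2.2.1, hf.2.2.2.2.2.1]) hy

lemma funAssoc_injOn {V : Set ℝ} (lam mu nu ro : Fin n → ℝ) :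
    Set.InjOn (funAssoc n) (leftCouples (DC V) lam mu nu ro) := by
  rintro ⟨f, g⟩ ⟨σ, -, hf, hg⟩ ⟨f', g'⟩ ⟨σ', -, hf', hg'⟩ e
  have hq : ∀ i j, i ≤ j → j ≤ n → tetra f g i i j = tetra f' g' i i j := by
    intro i j hij hj
    have := congrFun (congrFun (congrArg Prod.snd e) i) j
    simpa [funAssoc, onGrid, hij, hj] using this
  have hp : ∀ i j, i ≤ j → j ≤ n → tetra f g i j n = tetra f' g' i j n := by
    intro i j hij hj
    have := congrFun (congrFun (congrArg Prod.fst e) i) j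
    simp only [funAssoc, onGrid, hij, hj, and_self, if_true,
      hq 0 n (Nat.zero_le _) le_rfl] at this
    linarith
  have key : ∀ x y z, x ≤ y → y ≤ z → z ≤ n → tetra f g x y z = tetra f' g' x y z :=
    fun x y z hxy hyz hz => (isOctahedral_tetra n f g).eq_of_final_faces
      (isOctahedral_tetra n f' g') hp hq hxy hyz hz
  refine Prod.ext ?_ ?_ <;> funext i j <;> by_cases hij : i ≤ j ∧ j ≤ n
  · have := key 0 i j (Nat.zero_le _) hij.1 hij.2
    rwa [tetra_zero _ _ hij.1, tetra_zero _ _ hij.1] at this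
  · exact (hf.1 i j hij).trans (hf'.1 i j hij).symm
  · have := key i j j hij.1 le_rfl hij.2
    rwa [tetra_self' (fun y hy => DC_glue hf hg hy) _ hij.2,
      tetra_self' (fun y hy => DC_glue hf' hg' hy) _ hij.2] at this
  · exact (hg.1 i j hij).trans (hg'.1 i j hij).symm

/-- The reflection of a function on the grid, with a linear function added. -/
def reflectGrid (n : ℕ) (K L : ℝ) (h : ℕ → ℕ → ℝ) : ℕ → ℕ → ℝ :=
  onGrid n fun i j => h (n - j) (n - i) - h n n + K * i + L * j

lemma reflectGrid_of_le {K L : ℝ} {h : ℕ → ℕ → ℝ} {i j : ℕ} (hij : i ≤ j) (hj : j ≤ n) :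
    reflectGrid n K L h i j = h (n - j) (n - i) - h n n + K * i + L * j := by
  rw [reflectGrid, onGrid, if_pos ⟨hij, hj⟩]

/-- The reflection keeps the first kind of rhombus and exchanges the other two; it swaps the two
legs and replaces each boundary vector by its reversed complement. -/
lemma reflectGrid_mem {S : AddSubgroup ℝ} {K L : ℝ} (hK : K ∈ S) (hL : L ∈ S)
    {α β γ : Fin n → ℝ} {h : ℕ → ℕ → ℝ} (hh : h ∈ DC (S : Set ℝ) α β γ) :
    reflectGrid n K L h ∈ DC (S : Set ℝ) (fun k => L - β k.rev) (fun k => K - α k.rev)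
      (fun k => K + L - γ k.rev) := by
  obtain ⟨-, h0, ⟨r1, r2, r3⟩, hα, hβ, hγ, hV⟩ := hh
  refine ⟨fun i j hij => ?_, ?_, ⟨fun i j hi hj => ?_, fun i j hi hj => ?_,
    fun i j hi hj => ?_⟩, fun k => ?_, fun k => ?_, fun k => ?_, fun i j => ?_⟩
  · rw [reflectGrid, onGrid, if_neg hij]
  · rw [reflectGrid_of_le le_rfl (Nat.zero_le _)]; simp
  · rw [reflectGrid_of_le (by omega) (by omega), reflectGrid_of_le (by omega) (by omega),
      reflectGrid_of_le (by omega) (by omega), reflectGrid_of_le (by omega) (by omega)]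
    have := r1 (n - (j + 1)) (n - (i + 1)) (by omega) (by omega)
    rw [show n - (j + 1) + 1 = n - j by omega, show n - (i + 1) + 1 = n - i by omega] at this
    push_cast
    linarith
  · rw [reflectGrid_of_le (by omega) (by omega), reflectGrid_of_le (by omega) (by omega),
      reflectGrid_of_le (by omega) (by omega), reflectGrid_of_le (by omega) (by omega)]
    have := r3 (n - (j + 2)) (n - (i + 1)) (by omega) (by omega)
    rw [show n - (j + 2) + 1 = n - (j + 1) by omega, show n - (j + 2) + 2 = n - j by omega,
      show n - (i + 1) + 1 = n - i by omega] at this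
    push_cast
    linarith
  · rw [reflectGrid_of_le (by omega) (by omega), reflectGrid_of_le (by omega) (by omega),
      reflectGrid_of_le (by omega) (by omega), reflectGrid_of_le (by omega) (by omega)]
    have := r2 (n - (j + 1)) (n - (i + 2)) (by omega) (by omega)
    rw [show n - (j + 1) + 1 = n - j by omega, show n - (i + 2) + 1 = n - (i + 1) by omega,
      show n - (i + 2) + 2 = n - i by omega] at this
    push_cast
    linarith
  · rw [reflectGrid_of_le (by omega) (by omega), reflectGrid_of_le (by omega) (by omega)]
    have := hβ k.rev
    beta_reduce
    rw [Fin.val_rev, show n - (k + 1) + 1 = n - (k : ℕ) by omega] at this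
    rw [← this]
    push_cast
    simp only [Nat.sub_zero]
    ring
  · rw [reflectGrid_of_le (by omega) (by omega), reflectGrid_of_le (by omega) (by omega)]
    have := hα k.rev
    beta_reduce
    rw [Fin.val_rev, show n - (k + 1) + 1 = n - (k : ℕ) by omega] at this
    rw [← this]
    push_cast
    simp only [Nat.sub_self]
    ring
  · rw [reflectGrid_of_le (by omega) (by omega), reflectGrid_of_le (by omega) (by omega)]
    have := hγ k.rev
    beta_reduce
    rw [Fin.val_rev, show n - (k + 1) + 1 = n - (k : ℕ) by omega] at this
    rw [← this]
    push_cast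
    ring
  · rw [reflectGrid, onGrid]
    split_ifs
    · have e : ∀ (x : ℝ) (k : ℕ), x ∈ S → x * k ∈ S := fun x k hx => by
        rw [mul_comm, ← nsmul_eq_mul]; exact S.nsmul_mem hx k
      exact S.add_mem (S.add_mem (S.sub_mem (hV _ _) (hV _ _)) (e _ _ hK)) (e _ _ hL)
    · exact S.zero_mem

lemma isPartition_reflect {α : Fin n → ℝ} (hα : IsPartition α) {K : ℝ} (hK : ∀ k, α k ≤ K) :
    IsPartition fun k => K - α k.rev := by
  refine ⟨fun i j hij => ?_, fun i => by linarith [hK i.rev]⟩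
  have := hα.1 (Fin.rev_le_rev.2 hij)
  simp only
  linarith

/-- The step along the hypotenuse is a vertical step, at least `α k` by the first kind of rhombus,
followed by a horizontal one that `DC_diag_step` makes nonnegative. -/
lemma DC_diag_nonneg {V : Set ℝ} {α β γ : Fin n → ℝ} (hα : IsPartition α) (hβ : IsPartition β)
    {f : ℕ → ℕ → ℝ} (hf : f ∈ DC V α β γ) (k : Fin n) : 0 ≤ γ k := by
  have h1 := DC_diag_step hβ hf k.2
  obtain ⟨-, -, ⟨r1, -, -⟩, hfα, -, hfγ, -⟩ := hf
  have h2 : ∀ i : ℕ, i ≤ k → f 0 (k + 1) - f 0 k ≤ f i (k + 1) - f i k := by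
    intro i
    induction i with
    | zero => intro _; exact le_rfl
    | succ i ih =>
      intro hi
      linarith [r1 i k hi k.2, ih (by omega)]
  linarith [h2 k le_rfl, hfα k, hα.2 k, hfγ k]

variable (S : AddSubgroup ℝ)

/-- Couples of discrete concave functions come from couples of standard pairs. -/
lemma exists_leftCouple {lam mu nu ro : Fin n → ℝ} (hlam : IsPartition lam) (hmu : IsPartition mu)
    (hnu : IsPartition nu) (hro : IsPartition ro) {y : (ℕ → ℕ → ℝ) × (ℕ → ℕ → ℝ)}
    (hy : y ∈ leftCouples (DC (S : Set ℝ)) lam mu nu ro) :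
    ∃ x ∈ leftCouples (SP (S : Set ℝ)) lam mu nu ro, (toDC x.1, toDC x.2) = y := by
  obtain ⟨σ, hσ, h1, h2⟩ := hy
  obtain ⟨x1, hx1, e1⟩ := surjOn_toDC S hlam hmu hσ h1
  obtain ⟨x2, hx2, e2⟩ := surjOn_toDC S hσ hnu hro h2
  exact ⟨(x1, x2), ⟨σ, hσ, hx1, hx2⟩, Prod.ext e1 e2⟩

lemma funAssoc_toDC {lam mu nu ro : Fin n → ℝ} {x : (Arr n n × Arr n n) × (Arr n n × Arr n n)}
    (hx : x ∈ leftCouples (SP (S : Set ℝ)) lam mu nu ro) :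
    funAssoc n (toDC x.1, toDC x.2) = (toDC (arrayAssoc x).1, toDC (arrayAssoc x).2) := by
  obtain ⟨⟨a, b⟩, ⟨l, c⟩⟩ := x
  obtain ⟨σ, -, h1, h2⟩ := hx
  exact (isLeftCouple_of_mem S h1 h2).funAssoc_eq

lemma mapsTo_funAssoc {lam mu nu ro : Fin n → ℝ} (hlam : IsPartition lam) (hmu : IsPartition mu)
    (hnu : IsPartition nu) (hro : IsPartition ro) :
    Set.MapsTo (funAssoc n) (leftCouples (DC (S : Set ℝ)) lam mu nu ro)
      (rightCouples (DC (S : Set ℝ)) lam mu nu ro) := by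
  intro y hy
  obtain ⟨x, hx, rfl⟩ := exists_leftCouple S hlam hmu hnu hro hy
  rw [funAssoc_toDC S hx]
  obtain ⟨τ, hτ, h1, h2⟩ := mapsTo_arrayAssoc S lam mu nu ro hx
  exact ⟨τ, hτ, mapsTo_toDC S _ _ _ h1, mapsTo_toDC S _ _ _ h2⟩

lemma exists_bound {α : Fin n → ℝ} (hα : IsPartition α) : ∃ N : ℕ, ∀ k, α k ≤ N := by
  obtain ⟨N, hN⟩ := exists_nat_ge (∑ k, α k)
  exact ⟨N, fun k => (Finset.single_le_sum (fun i _ => hα.2 i) (Finset.mem_univ k)).trans hN⟩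

/-- The reflected couple goes to the reflected couple. -/
lemma funAssoc_reflect {V : Set ℝ} {lam mu nu ro τ : Fin n → ℝ} {p q : ℕ → ℕ → ℝ} {K : ℝ}
    (hp : p ∈ DC V mu nu τ) (hq : q ∈ DC V lam τ ro)
    (hglue : ∀ y ≤ n, reflectGrid n K (2 * K) q 0 y = reflectGrid n K K p y y) :
    funAssoc n
      (reflectGrid n K K
        (funAssoc n (reflectGrid n K K p, reflectGrid n K (2 * K) q)).1,
      reflectGrid n K (2 * K)
        (funAssoc n (reflectGrid n K K p, reflectGrid n K (2 * K) q)).2) = (p, q) := by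
  set f := reflectGrid n K K p with hf
  set g := reflectGrid n K (2 * K) q with hg
  set f' := reflectGrid n K K (funAssoc n (f, g)).1 with hf'
  set g' := reflectGrid n K (2 * K) (funAssoc n (f, g)).2 with hg'
  -- On the faces `x = 0` and `y = z` the term `K * (x + y + z)` becomes `K y + K z` and `K x + 2 K
  -- y`, whence the coefficients in the two `reflectGrid`s. The constant makes the value at the
  -- origin zero.
  set F : ℕ → ℕ → ℕ → ℝ := fun x y z =>
    tetra f g (n - z) (n - y) (n - x) + K * (x + y + z) + -tetra f g n n n with hF
  have key : ∀ x y z, x ≤ y → y ≤ z → z ≤ n → tetra f' g' x y z = F x y z := by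
    intro x y z hxy hyz hz
    refine (isOctahedral_tetra n f' g').eq_of_faces
      ((isOctahedral_tetra n f g).reflect K (-tetra f g n n n)) (fun y z hyz hz => ?_)
      (fun x y hxy hy => ?_) hxy hyz hz
    · rw [tetra_zero _ _ hyz, hf', reflectGrid_of_le hyz hz]
      simp only [funAssoc, onGrid]
      rw [if_pos ⟨by omega, by omega⟩, if_pos ⟨le_rfl, le_rfl⟩]
      simp only [Nat.sub_zero, Nat.cast_zero]
      ring
    · rw [tetra_self, hg', reflectGrid_of_le (by omega) hy]
      simp only [funAssoc, onGrid]
      rw [if_pos ⟨by omega, by omega⟩, if_pos ⟨le_rfl, le_rfl⟩]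
      push_cast
      ring
  have hnn : tetra f g n n n = g n n := tetra_self' hglue n le_rfl
  refine Prod.ext ?_ ?_ <;> funext i j <;> by_cases hij : i ≤ j ∧ j ≤ n
  · have h1 : (n : ℝ) - (n - i : ℕ) = i := by rw [Nat.cast_sub (by omega)]; ring
    have h2 : (n : ℝ) - (n - j : ℕ) = j := by rw [Nat.cast_sub (by omega)]; ring
    simp only [funAssoc, onGrid, if_pos hij]
    rw [key _ _ _ hij.1 hij.2 le_rfl, key _ _ _ le_rfl (Nat.zero_le _) le_rfl]
    simp only [hF, Nat.sub_self, Nat.sub_zero]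
    rw [tetra_zero _ _ (by omega), tetra_zero _ _ le_rfl, hf,
      reflectGrid_of_le (by omega) (by omega), reflectGrid_of_le le_rfl le_rfl]
    rw [show n - (n - i) = i by omega, show n - (n - j) = j by omega, Nat.sub_self, hp.2.1,
      Nat.cast_zero]
    linear_combination (-K) * h1 - K * h2
  · simp only [funAssoc, onGrid, if_neg hij]
    exact (hp.1 i j hij).symm
  · have h1 : (n : ℝ) - (n - i : ℕ) = i := by rw [Nat.cast_sub (by omega)]; ring
    have h2 : (n : ℝ) - (n - j : ℕ) = j := by rw [Nat.cast_sub (by omega)]; ring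
    simp only [funAssoc, onGrid, if_pos hij]
    rw [key _ _ _ le_rfl hij.1 hij.2]
    simp only [hF]
    rw [hnn, tetra_self' hglue _ (by omega), hg, reflectGrid_of_le (by omega) (by omega),
      reflectGrid_of_le le_rfl le_rfl]
    rw [show n - (n - i) = i by omega, show n - (n - j) = j by omega, Nat.sub_self, hq.2.1]
    linear_combination (-2 * K) * h1 - K * h2
  · simp only [funAssoc, onGrid, if_neg hij]
    exact (hq.1 i j hij).symm

lemma surjOn_funAssoc (h1 : (1 : ℝ) ∈ S) {lam mu nu ro : Fin n → ℝ} (hlam : IsPartition lam)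
    (hmu : IsPartition mu) (hnu : IsPartition nu) (hro : IsPartition ro) :
    Set.SurjOn (funAssoc n) (leftCouples (DC (S : Set ℝ)) lam mu nu ro)
      (rightCouples (DC (S : Set ℝ)) lam mu nu ro) := by
  rintro ⟨p, q⟩ ⟨τ, hτ, hp, hq⟩
  obtain ⟨N₁, hN₁⟩ := exists_bound hlam
  obtain ⟨N₂, hN₂⟩ := exists_bound hmu
  obtain ⟨N₃, hN₃⟩ := exists_bound hnu
  obtain ⟨N₄, hN₄⟩ := exists_bound hro
  obtain ⟨N₅, hN₅⟩ := exists_bound hτ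
  -- `K` bounds all parts, so that the complements are partitions again. It is a natural number,
  -- hence lies in `S`, which contains `1`.
  obtain ⟨K, hK⟩ : ∃ K : ℝ, K = ((N₁ + N₂ + N₃ + N₄ + N₅ : ℕ) : ℝ) := ⟨_, rfl⟩
  have hKS : K ∈ S := by
    rw [hK, ← mul_one (((_ : ℕ)) : ℝ), ← nsmul_eq_mul]
    exact S.nsmul_mem h1 _
  push_cast at hK
  have hKS2 : 2 * K ∈ S := by rw [two_mul]; exact S.add_mem hKS hKS
  have p₁ : (0 : ℝ) ≤ N₁ := Nat.cast_nonneg _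
  have p₂ : (0 : ℝ) ≤ N₂ := Nat.cast_nonneg _
  have p₃ : (0 : ℝ) ≤ N₃ := Nat.cast_nonneg _
  have p₄ : (0 : ℝ) ≤ N₄ := Nat.cast_nonneg _
  have p₅ : (0 : ℝ) ≤ N₅ := Nat.cast_nonneg _
  have hf := reflectGrid_mem hKS hKS hp
  have hg := reflectGrid_mem hKS hKS2 hq
  have e2 : K + K = 2 * K := by ring
  rw [e2] at hf
  have hlam' := isPartition_reflect hlam (K := K) fun k => by linarith [hN₁ k]
  have hmu' := isPartition_reflect hmu (K := K) fun k => by linarith [hN₂ k]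
  have hnu' := isPartition_reflect hnu (K := K) fun k => by linarith [hN₃ k]
  have hro' := isPartition_reflect hro (K := K + 2 * K) fun k => by linarith [hN₄ k]
  have hτ' := isPartition_reflect hτ (K := 2 * K) fun k => by linarith [hN₅ k]
  obtain ⟨σ, hσ, hp', hq'⟩ := mapsTo_funAssoc S hnu' hmu' hlam' hro'
    (show (reflectGrid n K K p, reflectGrid n K (2 * K) q) ∈ _ from ⟨_, hτ', hf, hg⟩)
  have hf' := reflectGrid_mem hKS hKS hp'
  have hg' := reflectGrid_mem hKS hKS2 hq'
  simp only [Fin.rev_rev, sub_sub_cancel] at hf' hg'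
  rw [e2] at hf'
  -- The middle vector is `2K` minus the reversed `σ`. It decreases because `σ` does; its
  -- nonnegativity is not a matter of the size of `K` but follows from concavity.
  refine ⟨_, ⟨_, ⟨fun i j hij => ?_, DC_diag_nonneg hlam hmu hf'⟩, hf', hg'⟩,
    funAssoc_reflect hp hq fun y hy => DC_glue hf hg hy⟩
  have := hσ.1 (Fin.rev_le_rev.2 hij)
  linarith

lemma bijOn_funAssoc (h1 : (1 : ℝ) ∈ S) {lam mu nu ro : Fin n → ℝ} (hlam : IsPartition lam)
    (hmu : IsPartition mu) (hnu : IsPartition nu) (hro : IsPartition ro) :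
    Set.BijOn (funAssoc n) (leftCouples (DC (S : Set ℝ)) lam mu nu ro)
      (rightCouples (DC (S : Set ℝ)) lam mu nu ro) :=
  ⟨mapsTo_funAssoc S hlam hmu hnu hro, funAssoc_injOn lam mu nu ro,
    surjOn_funAssoc S h1 hlam hmu hnu hro⟩

/-- Transport of the functional bijection: `toDC` is injective on standard pairs, intertwines the
two maps, and reaches every left couple of functions. -/
lemma bijOn_arrayAssoc (h1 : (1 : ℝ) ∈ S) {lam mu nu ro : Fin n → ℝ} (hlam : IsPartition lam)
    (hmu : IsPartition mu) (hnu : IsPartition nu) (hro : IsPartition ro) :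
    Set.BijOn arrayAssoc (leftCouples (SP (S : Set ℝ)) lam mu nu ro)
      (rightCouples (SP (S : Set ℝ)) lam mu nu ro) := by
  have hleft : ∀ x ∈ leftCouples (SP (S : Set ℝ)) lam mu nu ro,
      (toDC x.1, toDC x.2) ∈ leftCouples (DC (S : Set ℝ)) lam mu nu ro := by
    rintro x ⟨σ, hσ, hx1, hx2⟩
    exact ⟨σ, hσ, mapsTo_toDC S _ _ _ hx1, mapsTo_toDC S _ _ _ hx2⟩
  refine ⟨mapsTo_arrayAssoc S lam mu nu ro, fun x hx x' hx' e => ?_, fun y hy => ?_⟩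
  · have e' : (toDC x.1, toDC x.2) = (toDC x'.1, toDC x'.2) :=
      funAssoc_injOn lam mu nu ro (hleft x hx) (hleft x' hx')
        (by rw [funAssoc_toDC S hx, funAssoc_toDC S hx', e])
    obtain ⟨σ, -, hx1, hx2⟩ := hx
    obtain ⟨σ', -, hx1', hx2'⟩ := hx'
    exact Prod.ext (toDC_injOn hx1.1 hx1'.1 (congrArg Prod.fst e'))
      (toDC_injOn hx2.1 hx2'.1 (congrArg Prod.snd e'))
  · obtain ⟨τ, hτ, hy1, hy2⟩ := hy
    obtain ⟨z, hz, hzy⟩ := surjOn_funAssoc S h1 hlam hmu hnu hro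
      (show (toDC y.1, toDC y.2) ∈ _ from
        ⟨τ, hτ, mapsTo_toDC S _ _ _ hy1, mapsTo_toDC S _ _ _ hy2⟩)
    obtain ⟨x, hx, rfl⟩ := exists_leftCouple S hlam hmu hnu hro hz
    rw [funAssoc_toDC S hx] at hzy
    refine ⟨x, hx, ?_⟩
    obtain ⟨τ', -, hx1, hx2⟩ := mapsTo_arrayAssoc S lam mu nu ro hx
    exact Prod.ext (toDC_injOn hx1.1 hy1.1 (congrArg Prod.fst hzy))
      (toDC_injOn hx2.1 hy2.1 (congrArg Prod.snd hzy))

end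

end ArrayOR

end

theorem theorem3 (n : ℕ) (V : Set ℝ)
    (hV : V = Set.univ ∨ V = Set.range (fun z : ℤ => (z : ℝ)))
    (lam mu nu ro : Fin n → ℝ) (hlam : ArrayOR.IsPartition lam) (hmu : ArrayOR.IsPartition mu)
    (hnu : ArrayOR.IsPartition nu) (hro : ArrayOR.IsPartition ro) :
    -- the bijection between standard pairs and discrete concave functions
    (∀ α β γ : Fin n → ℝ,
      ArrayOR.IsPartition α → ArrayOR.IsPartition β → ArrayOR.IsPartition γ →
        Set.BijOn ArrayOR.toDC (ArrayOR.SP V α β γ) (ArrayOR.DC V α β γ)) ∧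
    -- a couple `((a, b), (l, c))` on the left has the form `((a, b), (𝐋(a ⊗ b), c))`, and for it
    -- `𝐋(b ⊗ c)` also has only zeros outside its first `n` columns
    (∀ x ∈ ArrayOR.leftCouples (ArrayOR.SP V) lam mu nu ro,
      ArrayOR.boldL (ArrayOR.concat x.1.1 x.1.2) =
          ArrayOR.concat x.2.1 (0 : ArrayOR.Arr n n) ∧
        ArrayOR.boldL (ArrayOR.concat x.1.2 x.2.2) =
          ArrayOR.concat (ArrayOR.arrayAssoc x).2.2 (0 : ArrayOR.Arr n n)) ∧
    -- the array associativity map is a bijection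
    Set.BijOn ArrayOR.arrayAssoc
      (ArrayOR.leftCouples (ArrayOR.SP V) lam mu nu ro)
      (ArrayOR.rightCouples (ArrayOR.SP V) lam mu nu ro) ∧
    -- the functional associativity map is a bijection
    Set.BijOn (ArrayOR.funAssoc n)
      (ArrayOR.leftCouples (ArrayOR.DC V) lam mu nu ro)
      (ArrayOR.rightCouples (ArrayOR.DC V) lam mu nu ro) ∧
    -- the two associativity bijections coincide
    (∀ x ∈ ArrayOR.leftCouples (ArrayOR.SP V) lam mu nu ro,
      ArrayOR.funAssoc n (ArrayOR.toDC x.1, ArrayOR.toDC x.2) =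
        (ArrayOR.toDC (ArrayOR.arrayAssoc x).1, ArrayOR.toDC (ArrayOR.arrayAssoc x).2)) := by
  obtain ⟨S, rfl, h1⟩ : ∃ S : AddSubgroup ℝ, V = (S : Set ℝ) ∧ (1 : ℝ) ∈ S := by
    rcases hV with rfl | rfl
    · exact ⟨⊤, rfl, AddSubgroup.mem_top _⟩
    · exact ⟨(Int.castAddHom ℝ).range, rfl, 1, by simp⟩
  refine ⟨fun α β γ hα hβ hγ => ArrayOR.bijOn_toDC S hα hβ hγ, ?_,
    ArrayOR.bijOn_arrayAssoc S h1 hlam hmu hnu hro, ArrayOR.bijOn_funAssoc S h1 hlam hmu hnu hro,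
    fun x hx => ArrayOR.funAssoc_toDC S hx⟩
  rintro ⟨⟨a, b⟩, ⟨l, c⟩⟩ ⟨σ, -, h1, h2⟩
  have h := ArrayOR.isLeftCouple_of_mem S h1 h2
  exact ⟨h.boldL_eq, h.boldL_eq'⟩
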